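/- **Setting.** Let $\mathcal X=\{x_1,\dots,x_M\}$ be a finite pool with a probability mass function $p>0$, $\mathcal Y$ a finite label set, and $y:\mathcal X\to\mathcal Y$ a deterministic oracle. Let $\ell:\mathcal X\times\mathcal Y\to\mathbb R^d$, $R=\sum_x p(x)\,\ell(x,y(x))$, let $g:\mathbb R^d\to\mathbb R^m$ be differentiable at $R$, and $G=g(R)$; $\mathrm D_g(r)$ is the Jacobian of $g$ at $r$. *Sampling.* Stage $t=1,2,\dots$ has a prescribed size $N_t\ge 1$. In stage $t$, given the past, $N_t$ instances are drawn i.i.d. (with replacement) from a proposal $q_{t-1}$ on $\mathcal X$ which is a function of the samples of the first $t-1$ stages, and their labels are revealed. Number all samples consecutively $X_1,X_2,\dots$, put $Y_j=y(X_j)$, let $\tilde q_{j-1}$ be the proposal from which $X_j$ is drawn, $\mathcal F_j=\sigma((X_1,Y_1),\dots,(X_j,Y_j))$, $W_j=p(X_j)/\tilde q_{j-1}(X_j)$, and $$\hat R_n^{\rm AIS}=\frac1n\sum_{j=1}^n W_j\,\ell(X_j,Y_j),\qquad \hat G_n^{\rm AIS}=g(\hat R_n^{\rm AIS}).$$ *Model.*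 Let $T$ be a finite rooted tree whose leaves index blocks of the pool, with $k_x$ the leaf assigned to $x$. The model has parameters $\theta\in\Delta(\mathcal Y)$ and $\psi_{y'}\in\Delta(\mathrm{leaves})$ for $y'\in\mathcal Y$, all strictly positive; independent priors $\theta\sim\mathrm{Dirichlet}(\alpha)$ and $\psi_{y'}\sim\mathrm{DirichletTree}(\beta_{y'};T)$, the latter with density proportional to $$\prod_{k\text{ leaf}}\psi_{y'k}^{\beta_{y'k}-1}\prod_{\nu\text{ inner}}\Big(\sum_{k\text{ below }\nu}\psi_{y'k}\Big)^{\beta_{y'\nu}-\sum_{c\text{ child of }\nu}\beta_{y'c}};$$ independently over instances, labels have law $\theta$ and, given label $y'$, blocks have law $\psi_{y'}$. Assume $\alpha_{y'}>1$ for all $y'$, and $\beta_{y'\nu}>\#\{\text{leaves below }\nu\}$ for all $y'$ and all $\nu\ne$ root (a leaf counts as below itself). After each stage $t\ge0$, EM is run for at least one iteration from any starting point in the parameter space, given the blocks and the labels observed so far: E-step $Q(\phi|\phi')=$ expected log posterior density of $\phi=(\theta,\psi)$ under the conditional law of the unobserved labels at $\phi'$, M-step $\phi\in\arg\max Q(\cdot|\phi')$.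 With the resulting $(\theta,\psi)$, let $\pi_t(\cdot|x)$ be the point mass at $y(x)$ if $x$ has been labeled, and $\pi_t(y'|x)\propto\psi_{y'k_x}\theta_{y'}$ otherwise. *Proposals.* For $t\ge0$, $$q_t(x)\ \propto\ p(x)\sum_{y'}\max\{\|\mathrm D_g(\hat R_t)\ell(x,y')\|_2,\ \epsilon_t\mathbb 1[\ell(x,y')\ne0]\}\,\pi_t(y'|x)$$ (an arbitrary proposal if all these weights vanish), where $\epsilon_t=\epsilon_0(1-\text{fraction of the pool labeled by the end of stage }t)$ with $\epsilon_0>0$, and $\hat R_t$ is a function of the samples of the first $t$ stages such that a.s. $\hat R_t\to\hat R_\infty$ for a constant vector $\hat R_\infty$ and $g$ is differentiable at $\hat R_t$ with $\|\mathrm D_g(\hat R_t)\|_2\le K<\infty$ for all $t\ge0$; $\mathrm D_g$ is continuous at $\hat R_\infty$. *Nondegeneracy.* $\ell(x,y(x))\neq0$ for at least one $x$, and $\mathrm D_g(\hat R_\infty)\,\ell(x,y(x))\ne0$ for every $x$ with $\ell(x,y(x))\ne0$. **Conclusion.** 1. Almost surely, $q_t(x)>0$ for all $x$ with $\ell(x,y(x))\neq0$,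 at every stage $t$ except possibly finitely many at which the whole pool is labeled and $\mathrm D_g(\hat R_t)\ell(x,y(x))=0\ne\ell(x,y(x))$ for some $x$. Moreover $\sup_j\mathbb E[W_j^2\mid\mathcal F_{j-1}]<\infty$ a.s., and $\hat G_n^{\rm AIS}\to G$ a.s. 2. For some $\eta>0$, $\sup_j\mathbb E[W_j^{2+\eta}\mid\mathcal F_{j-1}]<\infty$ a.s. There is a positive semidefinite matrix $V_\infty$ with $\operatorname{var}[W_j\ell(X_j,Y_j)-R\mid\mathcal F_{j-1}]\to V_\infty$ a.s., and $\sqrt n(\hat G_n^{\rm AIS}-G)$ converges in distribution to $\mathcal N(0,\Sigma)$ with $\Sigma=\mathrm D_g(R)V_\infty\mathrm D_g(R)^\intercal$. 3. (Asymptotic optimality.) If $\hat R_\infty=R$ and for every $x$ there is a label $y'$ with $\ell(x,y')\ne0$, then a.s. $q_t(x)\to q^\star(x)=v(x)/\sum_{x'}v(x')$ for all $x$, where $v(x)=p(x)\|\mathrm D_g(R)\ell(x,y(x))\|_2$, and $\operatorname{tr}\Sigma=(\sum_x v(x))^2-\|\mathrm D_g(R)R\|_2^2$; this is the minimum, over all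 proposals $q$ on $\mathcal X$ with $q(x)>0$ whenever $\ell(x,y(x))\ne0$, of the total asymptotic variance $\operatorname{tr}\big(\mathrm D_g(R)\operatorname{cov}_{X\sim q}[\tfrac{p(X)}{q(X)}\ell(X,y(X))]\mathrm D_g(R)^\intercal\big)$. -/

import Mathlib

open MeasureTheory ProbabilityTheory Filter Topology

noncomputable section

namespace DirichletTreeAIS

/-! ### Rooted trees -/

/-- A rooted tree with set of nodes `V`, given by its parent map
(the root is, by convention, its own parent). -/
structure RootedTree (V : Type*) where
  root : V
  parent : V → V
  parent_root : parent root = root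
  reaches_root : ∀ ν, ∃ n : ℕ, parent^[n] ν = root

namespace RootedTree

variable {V : Type*} (T : RootedTree V)

/-- `c` is a child of `ν`. -/
def IsChild (c ν : V) : Prop := c ≠ T.root ∧ T.parent c = ν

/-- `ν` is a leaf node; the other nodes are the inner nodes. -/
def IsLeaf (ν : V) : Prop := ∀ c, ¬ T.IsChild c ν

/-- The leaf nodes of the tree: they index the blocks of the partition. -/
def Leaf : Type _ := {ν : V // T.IsLeaf ν}

instance [Finite V] : Finite T.Leaf := inferInstanceAs (Finite {ν : V // T.IsLeaf ν})

instance [Finite V] : Fintype T.Leaf := Fintype.ofFinite _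

/-- `δ_ν(k) = 1`: the node `ν` is traversed on the way from the root to the leaf `k`
(both end points included). -/
def Traverses (ν : V) (k : T.Leaf) : Prop := ∃ n : ℕ, T.parent^[n] k.1 = ν

open Classical in
/-- The number of leaves that are reached through `ν`. -/
def numLeaves [Fintype V] (ν : V) : ℕ := Fintype.card {k : T.Leaf // T.Traverses ν k}

end RootedTree

/-! ### The Dirichlet-tree model of the labels of a finite pool -/

/-- Density of the Dirichlet distribution on the probability simplex, up to normalization. -/
def dirichletDensity {Y : Type*} [Fintype Y] (a θ : Y → ℝ) : ℝ := ∏ y, θ y ^ (a y - 1)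

open Classical in
/-- Density of the Dirichlet-tree distribution on the simplex of leaf probabilities,
up to normalization. (The parameter of the root has no effect: the factor belonging to the root
is a power of the total mass `1`.) -/
def dirichletTreeDensity {V : Type*} [Fintype V] (T : RootedTree V) (b : V → ℝ)
    (ψ : T.Leaf → ℝ) : ℝ :=
  (∏ k : T.Leaf, ψ k ^ (b k.1 - 1)) *
    ∏ ν : V with ¬ T.IsLeaf ν,
      (∑ k : T.Leaf with T.Traverses ν k, ψ k) ^ (b ν - ∑ c : V with T.IsChild c ν, b c)

/-- The specification of the model: a tree, the assignment of the pool instances to the blocks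
(leaves), and the hyperparameters `α` (Dirichlet prior of `θ`) and `β` (Dirichlet-tree prior
of `ψ_y`, for each label `y`). -/
structure Model (V X Y : Type*) where
  tree : RootedTree V
  block : X → tree.Leaf
  α : Y → ℝ
  β : Y → V → ℝ

namespace Model

variable {V X Y : Type*} (Md : Model V X Y)

/-- The parameters `(θ, ψ)` of the model. -/
structure Params where
  θ : Y → ℝ
  ψ : Y → Md.tree.Leaf → ℝ

variable {Md}

variable [Fintype V] [Fintype X] [Fintype Y]

/-- The hyperparameters are such that the prior (hence every posterior) has a mode in the open
simplices: `α_y > 1`, and `β_{yν}` exceeds the number of leaves below `ν` for `ν` not the root. -/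
def ProperPrior (Md : Model V X Y) : Prop :=
  (∀ y, 1 < Md.α y) ∧
    ∀ y ν, ν ≠ Md.tree.root → (Md.tree.numLeaves ν : ℝ) < Md.β y ν

/-- The parameter space: strictly positive probability vectors `θ` and `ψ_y`. -/
def paramSpace (Md : Model V X Y) : Set Md.Params :=
  {φ | (∀ y, 0 < φ.θ y) ∧ ∑ y, φ.θ y = 1 ∧
    (∀ y k, 0 < φ.ψ y k) ∧ ∀ y, ∑ k, φ.ψ y k = 1}

/-- Prior density of the parameters, up to normalization. -/
def priorDensity (φ : Md.Params) : ℝ :=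
  dirichletDensity Md.α φ.θ * ∏ y, dirichletTreeDensity Md.tree (Md.β y) (φ.ψ y)

/-- Likelihood of a full labelling `z` of the pool together with the observed block
assignments: `y_i ~ Categorical(θ)`, `k_i | y_i ~ Categorical(ψ_{y_i})`, independently in `i`. -/
def likelihood (φ : Md.Params) (z : X → Y) : ℝ :=
  ∏ x, φ.θ (z x) * φ.ψ (z x) (Md.block x)

/-- Posterior density of the parameters given a full labelling and the block assignments,
up to a factor that does not depend on the parameters. -/
def posteriorDensity (φ : Md.Params) (z : X → Y) : ℝ := priorDensity φ * likelihood φ z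

open Classical in
/-- The full labellings of the pool that agree with the oracle labels `y` on the set `O` of
instances that have been labelled. -/
def completions (y : X → Y) (O : Finset X) : Finset (X → Y) := {z | ∀ x ∈ O, z x = y x}

/-- Conditional probability of the full labelling `z` given the labels observed on `O`,
the block assignments, and the parameters `φ`. -/
def completionProb (φ : Md.Params) (y : X → Y) (O : Finset X) (z : X → Y) : ℝ :=
  likelihood φ z / ∑ z' ∈ completions y O, likelihood φ z'

/-- E-step: the expected log posterior `Q(φ | φ')`. -/
def emQ (y : X → Y) (O : Finset X) (φ' φ : Md.Params) : ℝ :=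
  ∑ z ∈ completions y O, completionProb φ' y O z * Real.log (posteriorDensity φ z)

/-- One iteration of EM leads from `φ'` to `φ`: the M-step maximizes `Q(· | φ')` over the
parameter space. -/
def IsEMStep (y : X → Y) (O : Finset X) (φ' φ : Md.Params) : Prop :=
  φ ∈ Md.paramSpace ∧ IsMaxOn (emQ y O φ') Md.paramSpace φ

/-- `φ` is obtained from some starting point in the parameter space by some positive number of
iterations of EM, given the labels observed on `O`. -/
def IsEMEstimate (y : X → Y) (O : Finset X) (φ : Md.Params) : Prop :=
  ∃ (n : ℕ) (s : ℕ → Md.Params), s 0 ∈ Md.paramSpace ∧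
    (∀ i ≤ n, IsEMStep y O (s i) (s (i + 1))) ∧ s (n + 1) = φ

open Classical in
/-- Posterior estimate `π(y' | x)` of the oracle response: a point mass at the true label if it
has been observed, and `∝ θ_{y'} ψ_{y' k_x}` otherwise. -/
def responsePosterior (φ : Md.Params) (y : X → Y) (O : Finset X) (x : X) (y' : Y) : ℝ :=
  if x ∈ O then (if y' = y x then 1 else 0)
  else φ.ψ y' (Md.block x) * φ.θ y' / ∑ y'', φ.ψ y'' (Md.block x) * φ.θ y''

end Model

/-! ### Generalized measures, proposals and variances (deterministic oracle) -/

section Measures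

variable {X Y : Type*} [Fintype X] [Fintype Y] {d m : ℕ}

/-- The risk vector `R = E[ℓ(X, y(X))]`, `X ~ p`. -/
def risk (p : X → ℝ) (ℓ : X → Y → EuclideanSpace ℝ (Fin d)) (y : X → Y) :
    EuclideanSpace ℝ (Fin d) := ∑ x, p x • ℓ x (y x)

/-- The Jacobian matrix `[∂ g_i / ∂ R_j]` of `g` at `r`. -/
def jacobian (g : EuclideanSpace ℝ (Fin d) → EuclideanSpace ℝ (Fin m))
    (r : EuclideanSpace ℝ (Fin d)) : Matrix (Fin m) (Fin d) ℝ :=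
  Matrix.of fun i j => fderiv ℝ g r (EuclideanSpace.single j 1) i

/-- `q` is a probability mass function on the pool. -/
def IsPmf (q : X → ℝ) : Prop := (∀ x, 0 ≤ q x) ∧ ∑ x, q x = 1

/-- The support of `q(x) p(y|x)` includes all `(x, y)` with `‖ℓ(x, y)‖ p(x, y) ≠ 0`, where
`p(y|x)` is the point mass at `y(x)`. -/
def HasSupport (p : X → ℝ) (ℓ : X → Y → EuclideanSpace ℝ (Fin d)) (y : X → Y)
    (q : X → ℝ) : Prop :=
  ∀ x, ‖ℓ x (y x)‖ * p x ≠ 0 → 0 < q x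

/-- `ε = ε₀ (1 - fraction of the pool that has been labelled)`. -/
def epsilon (ε₀ : ℝ) (O : Finset X) : ℝ := ε₀ * (1 - (O.card : ℝ) / Fintype.card X)

open Classical in
/-- The unnormalized proposal
`p(x) ∑_{y'} max {‖D_g(r) ℓ(x, y')‖, ε 𝟙[‖ℓ(x, y')‖ ≠ 0]} π(y'|x)`. -/
def proposalWeight (p : X → ℝ) (ℓ : X → Y → EuclideanSpace ℝ (Fin d))
    (g : EuclideanSpace ℝ (Fin d) → EuclideanSpace ℝ (Fin m))
    (r : EuclideanSpace ℝ (Fin d)) (ε : ℝ) (π : X → Y → ℝ) (x : X) : ℝ :=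
  p x * ∑ y', max ‖fderiv ℝ g r (ℓ x y')‖ (ε * if ‖ℓ x y'‖ ≠ 0 then 1 else 0) * π x y'

/-- The weight `v(x) = p(x) (∫ ‖D_g(R) ℓ(x, y)‖² p(y|x) dy)^{1/2} = p(x) ‖D_g(R) ℓ(x, y(x))‖`
of the asymptotically optimal proposal. -/
def optWeight (p : X → ℝ) (ℓ : X → Y → EuclideanSpace ℝ (Fin d))
    (g : EuclideanSpace ℝ (Fin d) → EuclideanSpace ℝ (Fin m)) (y : X → Y) (x : X) : ℝ :=
  p x * ‖fderiv ℝ g (risk p ℓ y) (ℓ x (y x))‖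

/-- The asymptotically optimal proposal `q⋆`. -/
def optProposal (p : X → ℝ) (ℓ : X → Y → EuclideanSpace ℝ (Fin d))
    (g : EuclideanSpace ℝ (Fin d) → EuclideanSpace ℝ (Fin m)) (y : X → Y) (x : X) : ℝ :=
  optWeight p ℓ g y x / ∑ x', optWeight p ℓ g y x'

/-- The covariance matrix of `(p(X)/q(X)) ℓ(X, y(X))` for `X ~ q` (with mean `R` when `q` has the
required support): the matrix `V_∞` of importance sampling with the fixed proposal `q`. -/
def proposalCov (p : X → ℝ) (ℓ : X → Y → EuclideanSpace ℝ (Fin d)) (y : X → Y)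
    (q : X → ℝ) : Matrix (Fin d) (Fin d) ℝ :=
  Matrix.of fun a b => ∑ x, q x *
    ((p x / q x * ℓ x (y x) a - risk p ℓ y a) * (p x / q x * ℓ x (y x) b - risk p ℓ y b))

/-- `Σ = D_g(R) V D_g(R)ᵀ`. -/
def deltaCov (p : X → ℝ) (ℓ : X → Y → EuclideanSpace ℝ (Fin d))
    (g : EuclideanSpace ℝ (Fin d) → EuclideanSpace ℝ (Fin m)) (y : X → Y)
    (V : Matrix (Fin d) (Fin d) ℝ) : Matrix (Fin m) (Fin m) ℝ :=
  jacobian g (risk p ℓ y) * V * (jacobian g (risk p ℓ y)).transpose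

end Measures

/-! ### Adaptive importance sampling -/

/-- The number of samples drawn in the first `t` stages; `N s` is the size of stage `s + 1`. -/
def sampleCount (N : ℕ → ℕ) (t : ℕ) : ℕ := ∑ s ∈ Finset.range t, N s

/-- The number `t` of completed stages when the sample with index `j` (counted from `0`) is
drawn; that sample is drawn from the proposal `q_t`. -/
def stage (N : ℕ → ℕ) (j : ℕ) : ℕ := Nat.findGreatest (fun t => sampleCount N t ≤ j) j

section Sampling

variable {Ω X Y : Type*} {d m : ℕ}

/-- The σ-algebra generated by the first `j` samples and their labels. -/
@[reducible] def sampleHistory (S : ℕ → Ω → X) (y : X → Y) (j : ℕ) : MeasurableSpace Ω :=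
  ⨆ i ∈ Finset.range j, MeasurableSpace.comap (fun ω => (S i ω, y (S i ω))) ⊤

open Classical in
/-- The set of instances whose label has been observed by the end of stage `t`. -/
def labelled (N : ℕ → ℕ) (S : ℕ → Ω → X) (t : ℕ) (ω : Ω) : Finset X :=
  (Finset.range (sampleCount N t)).image fun i => S i ω

/-- The importance weight `p(X_j) / q(X_j)` of the sample with index `j`. -/
def importanceWeight (N : ℕ → ℕ) (p : X → ℝ) (S : ℕ → Ω → X) (q : ℕ → Ω → X → ℝ)
    (j : ℕ) (ω : Ω) : ℝ := p (S j ω) / q (stage N j) ω (S j ω)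

/-- The estimate `R̂_n^AIS` after `n` samples. -/
def riskAIS (N : ℕ → ℕ) (p : X → ℝ) (ℓ : X → Y → EuclideanSpace ℝ (Fin d)) (y : X → Y)
    (S : ℕ → Ω → X) (q : ℕ → Ω → X → ℝ) (n : ℕ) (ω : Ω) : EuclideanSpace ℝ (Fin d) :=
  (1 / (n : ℝ)) • ∑ j ∈ Finset.range n,
    importanceWeight N p S q j ω • ℓ (S j ω) (y (S j ω))

/-- The estimate `Ĝ_n^AIS = g(R̂_n^AIS)` after `n` samples. -/
def measureAIS (N : ℕ → ℕ) (p : X → ℝ) (ℓ : X → Y → EuclideanSpace ℝ (Fin d))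
    (g : EuclideanSpace ℝ (Fin d) → EuclideanSpace ℝ (Fin m)) (y : X → Y)
    (S : ℕ → Ω → X) (q : ℕ → Ω → X → ℝ) (n : ℕ) (ω : Ω) : EuclideanSpace ℝ (Fin m) :=
  g (riskAIS N p ℓ y S q n ω)

/-- Component `a` of the contribution `(p(X_j)/q(X_j)) ℓ(X_j, Y_j) - R` of sample `j`. -/
def increment [Fintype X] (N : ℕ → ℕ) (p : X → ℝ) (ℓ : X → Y → EuclideanSpace ℝ (Fin d))
    (y : X → Y) (S : ℕ → Ω → X) (q : ℕ → Ω → X → ℝ) (j : ℕ) (a : Fin d) (ω : Ω) : ℝ :=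
  importanceWeight N p S q j ω * ℓ (S j ω) (y (S j ω)) a - risk p ℓ y a

/-- The conditional covariance matrix of the contribution of sample `j` given the previous
samples. -/
def condCov [Fintype X] [MeasurableSpace Ω] (μ : Measure Ω) (N : ℕ → ℕ) (p : X → ℝ)
    (ℓ : X → Y → EuclideanSpace ℝ (Fin d)) (y : X → Y) (S : ℕ → Ω → X) (q : ℕ → Ω → X → ℝ)
    (j : ℕ) (ω : Ω) : Matrix (Fin d) (Fin d) ℝ :=
  Matrix.of fun a b =>
    (μ[fun ω' =>
      (increment N p ℓ y S q j a ω' -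
        (μ[increment N p ℓ y S q j a | sampleHistory S y j]) ω') *
      (increment N p ℓ y S q j b ω' -
        (μ[increment N p ℓ y S q j b | sampleHistory S y j]) ω') | sampleHistory S y j]) ω

variable {V : Type*} [Fintype V] [Fintype X] [Fintype Y] [MeasurableSpace Ω]

open Classical in
/-- A run of adaptive importance sampling under the deterministic oracle `y`, with the response
estimated by EM in the Dirichlet-tree model `Md` and the proposals adapted to it.
`S j` is the instance drawn as sample `j` (counted from `0`); after `t` stages `φ t` are the
parameters returned by EM, `Rhat t` is the estimate of the risk, `q t` the proposal. -/
structure IsRun (μ : Measure Ω) (Md : Model V X Y) (N : ℕ → ℕ) (p : X → ℝ)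
    (ℓ : X → Y → EuclideanSpace ℝ (Fin d))
    (g : EuclideanSpace ℝ (Fin d) → EuclideanSpace ℝ (Fin m)) (y : X → Y) (ε₀ : ℝ)
    (S : ℕ → Ω → X) (φ : ℕ → Ω → Md.Params) (Rhat : ℕ → Ω → EuclideanSpace ℝ (Fin d))
    (q : ℕ → Ω → X → ℝ) : Prop where
  /-- the samples are random variables -/
  measurable_sample : ∀ j x, MeasurableSet (S j ⁻¹' {x})
  /-- what is computed after stage `t` is a function of the samples (and labels) so far -/
  param_history : ∀ t, (φ t).FactorsThrough fun ω (i : Fin (sampleCount N t)) => S i ω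
  risk_history : ∀ t, (Rhat t).FactorsThrough fun ω (i : Fin (sampleCount N t)) => S i ω
  proposal_history : ∀ t, (q t).FactorsThrough fun ω (i : Fin (sampleCount N t)) => S i ω
  /-- the model parameters are estimated from the observed labels by EM -/
  em : ∀ t ω, Model.IsEMEstimate y (labelled N S t ω) (φ t ω)
  /-- the proposals are probability mass functions on the pool -/
  proposal_pmf : ∀ t ω, IsPmf (q t ω)
  /-- `q_t ∝` the proposal weights (no constraint if all weights are zero) -/
  proposal_eq : ∀ t ω x,
    let w := proposalWeight p ℓ g (Rhat t ω) (epsilon ε₀ (labelled N S t ω))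
      (Model.responsePosterior (φ t ω) y (labelled N S t ω))
    q t ω x * ∑ x', w x' = w x
  /-- given the previous samples, sample `j` is drawn from the current proposal -/
  sample_law : ∀ j x,
    μ[(S j ⁻¹' {x}).indicator (fun _ => (1 : ℝ)) | sampleHistory S y j]
      =ᵐ[μ] fun ω => q (stage N j) ω x

end Sampling

end DirichletTreeAIS

end

/-!
The key point is that the proposals converge almost surely to a deterministic limit, so that the
run behaves in the end like importance sampling with a fixed proposal.

*Estimated posteriors.* Written in terms of branch probabilities, the Dirichlet-tree density is a
product of powers whose exponents `β - #leaves` are positive (`log_dirichletTreeDensity`), so a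
lower bound on the prior density keeps all parameters away from zero. The E-step objective averages
log posteriors over complete labellings, hence at its maximum it is at least a constant (its value
at a fixed reference parameter), and it never exceeds the log prior. This yields a bound on
`π(y' | x)` that is uniform in the stage, the observed labels and the starting point of EM
(`Model.ProperPrior.exists_le_responsePosterior`).

*Labelled instances.* An unlabelled instance with `ℓ(x, y') ≠ 0` for some `y'` therefore keeps a
probability of being drawn that is bounded below, and is labelled eventually; an instance with
`ℓ(x, ·) = 0` has weight zero and is never drawn (`IsRun.ae_eventually_labelled`). From then on the
weights are explicit functions of `R̂_t`, so the proposals converge, and eventually they charge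
exactly the instances with `ℓ(x, y(x)) ≠ 0` (`tendsto_adaptedProposal`). On a finite pool,
conditional expectations given the past are finite sums over the current proposal
(`IsRun.condExp_eq`), which gives the conditional moments and covariances and their limits.

*Limit theorems.* Setting a contribution to zero when its proposal is not yet close to the limit
changes only finitely many terms and produces uniformly bounded martingale differences. For these
a strong law follows from second moments along the squares
(`IsBoundedMDS.ae_tendsto_average`), and a central limit theorem from McLeish's product
`∏ (1 + i ξ_j / √n)`, which has expectation one (`IsBoundedMDS.tendsto_integral_exp`). Lévy's and
Slutsky's theorems and the delta method transfer it to `Ĝ_n` (`tendstoInDistribution_delta`).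

*Optimality.* The total variance is `∑ v(x)² / q(x) - ‖D_g(R) R‖²`, and Cauchy–Schwarz bounds the
sum below by `(∑ v(x))²` (`isLeast_trace_deltaCov`).
-/

namespace DirichletTreeAIS

/-! ### Masses of subtrees and the Dirichlet-tree density -/

namespace RootedTree

variable {V : Type*} (T : RootedTree V)

open Classical in
/-- The number of edges between a node and the root. -/
noncomputable def depth (ν : V) : ℕ := Nat.find (T.reaches_root ν)

lemma depth_of_ne_root {c : V} (hc : c ≠ T.root) : T.depth c = T.depth (T.parent c) + 1 := by
  classical
  exact Nat.find_comp_succ (T.reaches_root c) (T.reaches_root (T.parent c)) hc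

lemma depth_root : T.depth T.root = 0 := by
  classical
  exact (Nat.find_eq_zero _).2 rfl

lemma iterate_parent_root (n : ℕ) : T.parent^[n] T.root = T.root :=
  Function.iterate_fixed T.parent_root n

lemma depth_iterate_le (n : ℕ) (ν : V) : T.depth (T.parent^[n] ν) ≤ T.depth ν := by
  induction n generalizing ν with
  | zero => exact le_rfl
  | succ n ih =>
    rw [Function.iterate_succ_apply]
    refine (ih _).trans ?_
    by_cases h : ν = T.root
    · rw [h, T.parent_root]
    · rw [T.depth_of_ne_root h]; exact Nat.le_succ _

lemma traverses_root (k : T.Leaf) : T.Traverses T.root k := T.reaches_root k.1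

lemma Traverses.parent {T : RootedTree V} {c : V} {k : T.Leaf} (h : T.Traverses c k) :
    T.Traverses (T.parent c) k := by
  obtain ⟨n, hn⟩ := h
  exact ⟨n + 1, by rw [Function.iterate_succ_apply', hn]⟩

/-- In a finite tree every node has a leaf below it: a deepest descendant is a leaf. -/
lemma exists_traverses [Finite V] (ν : V) : ∃ k : T.Leaf, T.Traverses ν k := by
  obtain ⟨κ, ⟨n, hn⟩, hmax⟩ := Set.exists_max_image {κ | ∃ n, T.parent^[n] κ = ν} T.depth
    (Set.toFinite _) ⟨ν, 0, rfl⟩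
  refine ⟨⟨κ, fun c hc => ?_⟩, n, hn⟩
  have h1 := hmax c ⟨n + 1, by rw [Function.iterate_succ_apply, hc.2, hn]⟩
  have h2 := T.depth_of_ne_root hc.1
  rw [hc.2] at h2
  omega

lemma traverses_leaf_iff (k k' : T.Leaf) : T.Traverses k.1 k' ↔ k' = k := by
  constructor
  · rintro ⟨n, hn⟩
    refine Subtype.ext ?_
    induction n with
    | zero => exact hn
    | succ n ih =>
      rw [Function.iterate_succ_apply'] at hn
      by_cases hc : T.parent^[n] k'.1 = T.root
      · exact ih (by rw [hc, T.parent_root] at hn; rw [hc, hn])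
      · exact absurd ⟨hc, hn⟩ (k.2 (T.parent^[n] k'.1))
  · rintro rfl
    exact ⟨0, rfl⟩

variable [Fintype V]

open Classical in
/-- The total probability of the leaves below the node `ν`. -/
noncomputable def mass (ψ : T.Leaf → ℝ) (ν : V) : ℝ := ∑ k : T.Leaf with T.Traverses ν k, ψ k

/-- The logarithm of the probability of branching to the node `c` at its parent. -/
noncomputable def logBranch (ψ : T.Leaf → ℝ) (c : V) : ℝ :=
  Real.log (T.mass ψ c) - Real.log (T.mass ψ (T.parent c))

variable {T} {ψ : T.Leaf → ℝ}

lemma mass_leaf (ψ : T.Leaf → ℝ) (k : T.Leaf) : T.mass ψ k.1 = ψ k := by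
  classical
  simp [mass, traverses_leaf_iff, Finset.sum_filter]

lemma mass_root (ψ : T.Leaf → ℝ) : T.mass ψ T.root = ∑ k, ψ k := by
  classical
  simp [mass, traverses_root]

lemma mass_pos (hψ : ∀ k, 0 < ψ k) (ν : V) : 0 < T.mass ψ ν := by
  classical
  obtain ⟨k, hk⟩ := T.exists_traverses ν
  exact Finset.sum_pos (fun k _ => hψ k) ⟨k, by simpa using hk⟩

lemma logBranch_nonpos (hψ : ∀ k, 0 < ψ k) (c : V) : T.logBranch ψ c ≤ 0 := by
  classical
  refine sub_nonpos.2 (Real.log_le_log (mass_pos hψ c) ?_)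
  refine Finset.sum_le_sum_of_subset_of_nonneg (fun k hk => ?_) fun k _ _ => (hψ k).le
  simp only [Finset.mem_filter, Finset.mem_univ, true_and] at hk ⊢
  exact hk.parent

open Classical in
/-- The chain rule along the path from the root to the node `κ`. -/
lemma log_mass_eq_sum_logBranch (hψ1 : ∑ k, ψ k = 1) (κ : V) :
    Real.log (T.mass ψ κ) =
      ∑ c : V with c ≠ T.root ∧ ∃ n, T.parent^[n] κ = c, T.logBranch ψ c := by
  induction h : T.depth κ generalizing κ with
  | zero =>
    have hκ : κ = T.root := by
      by_contra hne
      have := T.depth_of_ne_root hne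
      omega
    subst hκ
    rw [mass_root, hψ1, Real.log_one, Finset.filter_false_of_mem, Finset.sum_empty]
    rintro c - ⟨hc, n, hn⟩
    exact hc (hn ▸ T.iterate_parent_root n)
  | succ D ih =>
    have hκ : κ ≠ T.root := by
      rintro rfl
      rw [T.depth_root] at h
      omega
    have hd := T.depth_of_ne_root hκ
    have hset : (Finset.univ.filter fun c => c ≠ T.root ∧ ∃ n, T.parent^[n] κ = c) =
        insert κ (Finset.univ.filter
          fun c => c ≠ T.root ∧ ∃ n, T.parent^[n] (T.parent κ) = c) := by
      ext c
      simp only [Finset.mem_filter, Finset.mem_univ, true_and, Finset.mem_insert]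
      constructor
      · rintro ⟨hc, n, hn⟩
        cases n with
        | zero => exact Or.inl hn.symm
        | succ n => exact Or.inr ⟨hc, n, hn⟩
      · rintro (rfl | ⟨hc, n, hn⟩)
        · exact ⟨hκ, 0, rfl⟩
        · exact ⟨hc, n + 1, hn⟩
    rw [hset, Finset.sum_insert, ← ih (T.parent κ) (by omega), logBranch]
    · ring
    · simp only [Finset.mem_filter, Finset.mem_univ, true_and, not_and, not_exists]
      intro _ n hn
      have := T.depth_iterate_le n (T.parent κ)
      rw [hn] at this
      omega

open Classical in
lemma log_leaf_eq_sum_logBranch (hψ1 : ∑ k, ψ k = 1) (k : T.Leaf) :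
    Real.log (ψ k) = ∑ c : V with c ≠ T.root ∧ T.Traverses c k, T.logBranch ψ c := by
  rw [← mass_leaf ψ k, log_mass_eq_sum_logBranch hψ1]
  rfl

end RootedTree

open DirichletTreeAIS.RootedTree

section Density

variable {V : Type*} [Fintype V] {T : RootedTree V} {ψ : T.Leaf → ℝ}

lemma dirichletTreeDensity_pos (b : V → ℝ) (hψ : ∀ k, 0 < ψ k) :
    0 < dirichletTreeDensity T b ψ :=
  mul_pos (Finset.prod_pos fun k _ => Real.rpow_pos_of_pos (hψ k) _)
    (Finset.prod_pos fun ν _ => Real.rpow_pos_of_pos (mass_pos hψ ν) _)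

open Classical in
/-- In terms of the branch probabilities the Dirichlet-tree density is a product of powers, in
which the branch to `c` has the exponent `b c` minus the number of leaves below `c`. -/
lemma log_dirichletTreeDensity (b : V → ℝ) (hψ : ∀ k, 0 < ψ k) (hψ1 : ∑ k, ψ k = 1) :
    Real.log (dirichletTreeDensity T b ψ) =
      ∑ c : V with c ≠ T.root, (b c - T.numLeaves c) * T.logBranch ψ c := by
  have hmass : ∀ ν, 0 < T.mass ψ ν := mass_pos hψ
  have hlog : Real.log (dirichletTreeDensity T b ψ) =
      ∑ k : T.Leaf, (b k.1 - 1) * Real.log (T.mass ψ k.1) +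
        ∑ ν : V with ¬ T.IsLeaf ν,
          (b ν - ∑ c : V with T.IsChild c ν, b c) * Real.log (T.mass ψ ν) := by
    have hform : dirichletTreeDensity T b ψ = (∏ k : T.Leaf, ψ k ^ (b k.1 - 1)) *
        ∏ ν : V with ¬ T.IsLeaf ν, T.mass ψ ν ^ (b ν - ∑ c : V with T.IsChild c ν, b c) := rfl
    rw [hform, Real.log_mul (Finset.prod_pos fun k _ => Real.rpow_pos_of_pos (hψ k) _).ne'
      (Finset.prod_pos fun ν _ => Real.rpow_pos_of_pos (hmass ν) _).ne',
      Real.log_prod (fun k _ => (Real.rpow_pos_of_pos (hψ k) _).ne'),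
      Real.log_prod (fun ν _ => (Real.rpow_pos_of_pos (hmass ν) _).ne')]
    congr 1
    · refine Finset.sum_congr rfl fun k _ => ?_
      rw [Real.log_rpow (hψ k), mass_leaf]
    · refine Finset.sum_congr rfl fun ν _ => ?_
      exact Real.log_rpow (hmass ν) _
  -- Every `b ν` occurs with `log (mass ν)` for the node itself and with the mass of its parent.
  have hleaf : ∑ k : T.Leaf, b k.1 * Real.log (T.mass ψ k.1) =
      ∑ ν : V with T.IsLeaf ν, b ν * Real.log (T.mass ψ ν) :=
    (Finset.sum_subtype _ (by simp) fun ν => b ν * Real.log (T.mass ψ ν)).symm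
  have hchild : ∑ ν : V with ¬ T.IsLeaf ν,
        (∑ c : V with T.IsChild c ν, b c) * Real.log (T.mass ψ ν) =
      ∑ c : V with c ≠ T.root, b c * Real.log (T.mass ψ (T.parent c)) := by
    rw [Finset.sum_filter_of_ne]
    · simp_rw [Finset.sum_mul, Finset.sum_filter]
      rw [Finset.sum_comm]
      refine Finset.sum_congr rfl fun c _ => ?_
      by_cases hc : c = T.root <;> simp [IsChild, hc]
    · intro ν _ h hν
      refine h ?_
      rw [Finset.filter_false_of_mem fun c _ => hν c, Finset.sum_empty, zero_mul]
  -- The exponents `-1` at the leaves: each branch is counted once per leaf below it.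
  have hpath : ∑ k : T.Leaf, Real.log (T.mass ψ k.1) =
      ∑ c : V with c ≠ T.root, (T.numLeaves c : ℝ) * T.logBranch ψ c := by
    simp_rw [mass_leaf, log_leaf_eq_sum_logBranch hψ1, Finset.sum_filter]
    rw [Finset.sum_comm]
    refine Finset.sum_congr rfl fun c _ => ?_
    by_cases hc : c = T.root
    · simp [hc]
    · simp only [ne_eq, hc, not_false_eq_true, true_and, if_true]
      rw [← Finset.sum_filter, Finset.sum_const, nsmul_eq_mul, numLeaves,
        Fintype.card_subtype]
  have hall : ∑ ν : V, b ν * Real.log (T.mass ψ ν) =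
      ∑ c : V with c ≠ T.root, b c * Real.log (T.mass ψ c) := by
    symm
    refine Finset.sum_filter_of_ne fun ν _ h => ?_
    contrapose! h
    rw [h, mass_root, hψ1, Real.log_one, mul_zero]
  simp_rw [sub_mul, Finset.sum_sub_distrib, one_mul] at hlog
  rw [hlog, hleaf, hchild, hpath]
  have hsplit := Finset.sum_filter_add_sum_filter_not Finset.univ T.IsLeaf
    fun ν => b ν * Real.log (T.mass ψ ν)
  rw [hall] at hsplit
  have hR : ∑ c : V with c ≠ T.root, (b c - T.numLeaves c) * T.logBranch ψ c =
      ∑ c : V with c ≠ T.root, b c * Real.log (T.mass ψ c) -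
      ∑ c : V with c ≠ T.root, b c * Real.log (T.mass ψ (T.parent c)) -
      ∑ c : V with c ≠ T.root, (T.numLeaves c : ℝ) * T.logBranch ψ c := by
    rw [← Finset.sum_sub_distrib, ← Finset.sum_sub_distrib]
    refine Finset.sum_congr rfl fun c _ => ?_
    rw [logBranch]; ring
  rw [hR]
  linarith

end Density

/-! ### A uniform lower bound on the parameters returned by EM -/

namespace Model

variable {V X Y : Type*} [Fintype V] [Fintype Y] {Md : Model V X Y}

lemma priorDensity_pos {φ : Md.Params} (hφ : φ ∈ Md.paramSpace) : 0 < priorDensity φ :=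
  mul_pos (Finset.prod_pos fun y _ => Real.rpow_pos_of_pos (hφ.1 y) _)
    (Finset.prod_pos fun y _ => dirichletTreeDensity_pos _ (hφ.2.2.1 y))

lemma theta_le_one {φ : Md.Params} (hφ : φ ∈ Md.paramSpace) (y : Y) : φ.θ y ≤ 1 := by
  rw [← hφ.2.1]
  exact Finset.single_le_sum (fun y _ => (hφ.1 y).le) (Finset.mem_univ y)

lemma psi_le_one {φ : Md.Params} (hφ : φ ∈ Md.paramSpace) (y : Y) (k : Md.tree.Leaf) :
    φ.ψ y k ≤ 1 := by
  rw [← hφ.2.2.2 y]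
  exact Finset.single_le_sum (fun k _ => (hφ.2.2.1 y k).le) (Finset.mem_univ k)

open Classical in
lemma log_priorDensity {φ : Md.Params} (hφ : φ ∈ Md.paramSpace) :
    Real.log (priorDensity φ) = ∑ y, (Md.α y - 1) * Real.log (φ.θ y) +
      ∑ y, ∑ c : V with c ≠ Md.tree.root,
        (Md.β y c - Md.tree.numLeaves c) * Md.tree.logBranch (φ.ψ y) c := by
  rw [priorDensity, dirichletDensity, Real.log_mul, Real.log_prod, Real.log_prod]
  · congr 1
    · exact Finset.sum_congr rfl fun y _ => Real.log_rpow (hφ.1 y) _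
    · exact Finset.sum_congr rfl fun y _ =>
        log_dirichletTreeDensity _ (hφ.2.2.1 y) (hφ.2.2.2 y)
  · exact fun y _ => (dirichletTreeDensity_pos _ (hφ.2.2.1 y)).ne'
  · exact fun y _ => (Real.rpow_pos_of_pos (hφ.1 y) _).ne'
  · exact (Finset.prod_pos fun y _ => Real.rpow_pos_of_pos (hφ.1 y) _).ne'
  · exact (Finset.prod_pos fun y _ => dirichletTreeDensity_pos _ (hφ.2.2.1 y)).ne'

lemma le_of_le_sum_nonpos {ι : Type*} {s : Finset ι} {f : ι → ℝ} {C : ℝ}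
    (hf : ∀ i ∈ s, f i ≤ 0) (h : C ≤ ∑ i ∈ s, f i) {i : ι} (hi : i ∈ s) : C ≤ f i := by
  have h2 := Finset.single_le_sum (f := fun i => - f i) (fun j hj => neg_nonneg.2 (hf j hj)) hi
  rw [Finset.sum_neg_distrib] at h2
  linarith

/-- Under a proper prior, a lower bound on the prior density keeps the parameters away from the
boundary of the simplices: all terms of the log density in branch coordinates are nonpositive,
with positive coefficients. -/
lemma ProperPrior.exists_le_params (hMd : Md.ProperPrior) (C : ℝ) :
    ∃ δ > 0, ∀ φ ∈ Md.paramSpace, C ≤ Real.log (priorDensity φ) →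
      (∀ y, δ ≤ φ.θ y) ∧ ∀ y k, δ ≤ φ.ψ y k := by
  classical
  obtain ⟨B, hB0, hCB⟩ : ∃ B : ℝ, 0 ≤ B ∧ -B ≤ C := ⟨|C|, abs_nonneg C, neg_abs_le C⟩
  set A₁ := ∑ y, B / (Md.α y - 1) with hA₁
  set A₂ := ∑ y, ∑ c : V with c ≠ Md.tree.root, B / (Md.β y c - Md.tree.numLeaves c) with hA₂
  have hα : ∀ y, 0 < Md.α y - 1 := fun y => sub_pos.2 (hMd.1 y)
  have hβ : ∀ y, ∀ c ∈ Finset.univ.filter (fun c => c ≠ Md.tree.root),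
      0 < Md.β y c - Md.tree.numLeaves c := fun y c hc =>
    sub_pos.2 (hMd.2 y c (Finset.mem_filter.1 hc).2)
  have hA₁0 : 0 ≤ A₁ := Finset.sum_nonneg fun y _ => div_nonneg hB0 (hα y).le
  have hA₂' : ∀ y, 0 ≤ ∑ c : V with c ≠ Md.tree.root, B / (Md.β y c - Md.tree.numLeaves c) :=
    fun y => Finset.sum_nonneg fun c hc => div_nonneg hB0 (hβ y c hc).le
  have hA₂0 : 0 ≤ A₂ := Finset.sum_nonneg fun y _ => hA₂' y
  refine ⟨Real.exp (-(A₁ + A₂)), Real.exp_pos _, fun φ hφ hlog => ?_⟩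
  rw [log_priorDensity hφ] at hlog
  have hθ0 : ∀ y ∈ Finset.univ, (Md.α y - 1) * Real.log (φ.θ y) ≤ 0 := fun y _ =>
    mul_nonpos_of_nonneg_of_nonpos (hα y).le
      (Real.log_nonpos (hφ.1 y).le (theta_le_one hφ y))
  have hψ0 : ∀ y, ∀ c ∈ Finset.univ.filter (fun c => c ≠ Md.tree.root),
      (Md.β y c - Md.tree.numLeaves c) * Md.tree.logBranch (φ.ψ y) c ≤ 0 := fun y c hc =>
    mul_nonpos_of_nonneg_of_nonpos (hβ y c hc).le
      (RootedTree.logBranch_nonpos (hφ.2.2.1 y) c)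
  have hψ1 : ∀ y ∈ Finset.univ, ∑ c : V with c ≠ Md.tree.root,
      (Md.β y c - Md.tree.numLeaves c) * Md.tree.logBranch (φ.ψ y) c ≤ 0 := fun y _ =>
    Finset.sum_nonpos (hψ0 y)
  have h1 := Finset.sum_nonpos hθ0
  have h2 := Finset.sum_nonpos hψ1
  refine ⟨fun y => ?_, fun y k => ?_⟩
  · rw [← Real.le_log_iff_exp_le (hφ.1 y)]
    have h3 : -B ≤ (Md.α y - 1) * Real.log (φ.θ y) :=
      le_of_le_sum_nonpos hθ0 (by linarith) (Finset.mem_univ y)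
    have h4 : -(B / (Md.α y - 1)) ≤ Real.log (φ.θ y) := by
      rw [← neg_div, div_le_iff₀ (hα y)]; linarith
    have h5 : B / (Md.α y - 1) ≤ A₁ :=
      Finset.single_le_sum (f := fun y => B / (Md.α y - 1))
        (fun y _ => div_nonneg hB0 (hα y).le) (Finset.mem_univ y)
    linarith
  · rw [← Real.le_log_iff_exp_le (hφ.2.2.1 y k),
      RootedTree.log_leaf_eq_sum_logBranch (hφ.2.2.2 y)]
    have h3 : ∀ c ∈ Finset.univ.filter (fun c => c ≠ Md.tree.root),
        -(B / (Md.β y c - Md.tree.numLeaves c)) ≤ Md.tree.logBranch (φ.ψ y) c := by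
      intro c hc
      have h4 : -B ≤ (Md.β y c - Md.tree.numLeaves c) * Md.tree.logBranch (φ.ψ y) c :=
        le_of_le_sum_nonpos (hψ0 y)
          (le_of_le_sum_nonpos hψ1 (by linarith) (Finset.mem_univ y)) hc
      rw [← neg_div, div_le_iff₀ (hβ y c hc)]; linarith
    have h5 : ∑ c : V with c ≠ Md.tree.root, B / (Md.β y c - Md.tree.numLeaves c) ≤ A₂ :=
      Finset.single_le_sum
        (f := fun y => ∑ c : V with c ≠ Md.tree.root, B / (Md.β y c - Md.tree.numLeaves c))
        (fun y _ => hA₂' y) (Finset.mem_univ y)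
    have h6 : ∑ c : V with c ≠ Md.tree.root, -(B / (Md.β y c - Md.tree.numLeaves c)) ≤
        ∑ c : V with c ≠ Md.tree.root, Md.tree.logBranch (φ.ψ y) c := Finset.sum_le_sum h3
    have h7 : ∑ c : V with c ≠ Md.tree.root, Md.tree.logBranch (φ.ψ y) c ≤
        ∑ c : V with c ≠ Md.tree.root ∧ Md.tree.Traverses c k,
          Md.tree.logBranch (φ.ψ y) c := by
      rw [← neg_le_neg_iff, ← Finset.sum_neg_distrib, ← Finset.sum_neg_distrib]
      refine Finset.sum_le_sum_of_subset_of_nonneg (fun c hc => ?_) fun c _ _ =>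
        neg_nonneg.2 (RootedTree.logBranch_nonpos (hφ.2.2.1 y) c)
      simp only [Finset.mem_filter, Finset.mem_univ, true_and] at hc ⊢
      exact hc.1
    rw [Finset.sum_neg_distrib] at h6
    linarith

lemma responsePosterior_nonneg {φ : Md.Params} (hφ : φ ∈ Md.paramSpace) (y : X → Y)
    (O : Finset X) (x : X) (y' : Y) : 0 ≤ responsePosterior φ y O x y' := by
  rw [responsePosterior]
  split_ifs
  · exact zero_le_one
  · exact le_rfl
  · exact div_nonneg (mul_pos (hφ.2.2.1 _ _) (hφ.1 _)).le
      (Finset.sum_nonneg fun y'' _ => (mul_pos (hφ.2.2.1 _ _) (hφ.1 _)).le)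

lemma responsePosterior_le_one {φ : Md.Params} (hφ : φ ∈ Md.paramSpace) (y : X → Y)
    (O : Finset X) (x : X) (y' : Y) : responsePosterior φ y O x y' ≤ 1 := by
  have hpos : ∀ y'', 0 ≤ φ.ψ y'' (Md.block x) * φ.θ y'' := fun y'' =>
    (mul_pos (hφ.2.2.1 _ _) (hφ.1 _)).le
  rw [responsePosterior]
  split_ifs
  · exact le_rfl
  · exact zero_le_one
  · exact div_le_one_of_le₀ (Finset.single_le_sum (fun y'' _ => hpos y'') (Finset.mem_univ y'))
      (Finset.sum_nonneg fun y'' _ => hpos y'')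

variable [Fintype X]

lemma likelihood_pos {φ : Md.Params} (hφ : φ ∈ Md.paramSpace) (z : X → Y) :
    0 < likelihood φ z :=
  Finset.prod_pos fun _ _ => mul_pos (hφ.1 _) (hφ.2.2.1 _ _)

lemma likelihood_le_one {φ : Md.Params} (hφ : φ ∈ Md.paramSpace) (z : X → Y) :
    likelihood φ z ≤ 1 :=
  Finset.prod_le_one (fun _ _ => (mul_pos (hφ.1 _) (hφ.2.2.1 _ _)).le) fun _ _ =>
    mul_le_one₀ (theta_le_one hφ _) (hφ.2.2.1 _ _).le (psi_le_one hφ _ _)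

lemma log_posteriorDensity_le {φ : Md.Params} (hφ : φ ∈ Md.paramSpace) (z : X → Y) :
    Real.log (posteriorDensity φ z) ≤ Real.log (priorDensity φ) :=
  Real.log_le_log (mul_pos (priorDensity_pos hφ) (likelihood_pos hφ z))
    (mul_le_of_le_one_right (priorDensity_pos hφ).le (likelihood_le_one hφ z))

lemma sum_likelihood_pos {φ : Md.Params} (hφ : φ ∈ Md.paramSpace) (y : X → Y) (O : Finset X) :
    0 < ∑ z ∈ completions y O, likelihood φ z :=
  Finset.sum_pos (fun z _ => likelihood_pos hφ z) ⟨y, by simp [completions]⟩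

lemma completionProb_nonneg {φ : Md.Params} (hφ : φ ∈ Md.paramSpace) (y : X → Y) (O : Finset X)
    (z : X → Y) : 0 ≤ completionProb φ y O z :=
  div_nonneg (likelihood_pos hφ z).le (sum_likelihood_pos hφ y O).le

lemma sum_completionProb {φ : Md.Params} (hφ : φ ∈ Md.paramSpace) (y : X → Y) (O : Finset X) :
    ∑ z ∈ completions y O, completionProb φ y O z = 1 := by
  simp_rw [completionProb, ← Finset.sum_div]
  exact div_self (sum_likelihood_pos hφ y O).ne'

/-- The prior density at a maximizer of the E-step objective is bounded below by the smallest
posterior density at a reference parameter: the objective is an average of log posteriors, and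
the log likelihoods of complete labellings are nonpositive. -/
lemma IsEMStep.le_log_priorDensity {y : X → Y} {O : Finset X} {φ' φ φ₀ : Md.Params}
    (h : IsEMStep y O φ' φ) (hφ' : φ' ∈ Md.paramSpace) (hφ₀ : φ₀ ∈ Md.paramSpace) {C : ℝ}
    (hC : ∀ z, C ≤ Real.log (posteriorDensity φ₀ z)) : C ≤ Real.log (priorDensity φ) := by
  have hsum := sum_completionProb hφ' y O
  have hnn := completionProb_nonneg hφ' y O
  calc C = ∑ z ∈ completions y O, completionProb φ' y O z * C := by
        rw [← Finset.sum_mul, hsum, one_mul]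
    _ ≤ emQ y O φ' φ₀ :=
        Finset.sum_le_sum fun z _ => mul_le_mul_of_nonneg_left (hC z) (hnn z)
    _ ≤ emQ y O φ' φ := h.2 hφ₀
    _ ≤ ∑ z ∈ completions y O, completionProb φ' y O z * Real.log (priorDensity φ) :=
        Finset.sum_le_sum fun z _ =>
          mul_le_mul_of_nonneg_left (log_posteriorDensity_le h.1 z) (hnn z)
    _ = Real.log (priorDensity φ) := by rw [← Finset.sum_mul, hsum, one_mul]

lemma IsEMEstimate.mem_paramSpace {y : X → Y} {O : Finset X} {φ : Md.Params}
    (h : IsEMEstimate y O φ) : φ ∈ Md.paramSpace := by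
  obtain ⟨n, s, -, hs, rfl⟩ := h
  exact (hs n le_rfl).1

/-- EM estimates stay away from the boundary of the parameter space, uniformly in the observed
labels, the starting point and the number of iterations. -/
theorem ProperPrior.exists_le_of_isEMEstimate (hMd : Md.ProperPrior) (y : X → Y) :
    ∃ δ > 0, ∀ (O : Finset X) (φ : Md.Params), IsEMEstimate y O φ →
      (∀ y', δ ≤ φ.θ y') ∧ ∀ y' k, δ ≤ φ.ψ y' k := by
  by_cases hne : Md.paramSpace.Nonempty
  · obtain ⟨φ₀, hφ₀⟩ := hne
    obtain ⟨C, hC⟩ := (Set.finite_range fun z : X → Y =>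
      Real.log (posteriorDensity φ₀ z)).bddBelow
    obtain ⟨δ, hδ, h⟩ := hMd.exists_le_params C
    refine ⟨δ, hδ, fun O φ hφ => h φ hφ.mem_paramSpace ?_⟩
    obtain ⟨n, s, hs0, hs, rfl⟩ := hφ
    have hsn : s n ∈ Md.paramSpace := by
      cases n with
      | zero => exact hs0
      | succ n => exact (hs n (Nat.le_succ n)).1
    exact (hs n le_rfl).le_log_priorDensity hsn hφ₀ fun z => hC ⟨z, rfl⟩
  · exact ⟨1, one_pos, fun O φ hφ => absurd ⟨φ, hφ.mem_paramSpace⟩ hne⟩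

/-- The posterior probability of every label of an unlabelled instance is bounded below. -/
theorem ProperPrior.exists_le_responsePosterior (hMd : Md.ProperPrior) (y : X → Y) :
    ∃ δ > 0, ∀ (O : Finset X) (φ : Md.Params), IsEMEstimate y O φ → ∀ x ∉ O, ∀ y',
      δ ≤ responsePosterior φ y O x y' := by
  obtain ⟨δ, hδ, h⟩ := hMd.exists_le_of_isEMEstimate y
  refine ⟨δ * δ, mul_pos hδ hδ, fun O φ hφ x hx y' => ?_⟩
  have hmem := hφ.mem_paramSpace
  obtain ⟨hθ, hψ⟩ := h O φ hφ
  have hpos : ∀ y'', 0 < φ.ψ y'' (Md.block x) * φ.θ y'' := fun y'' =>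
    mul_pos (hmem.2.2.1 _ _) (hmem.1 _)
  have hsum : ∑ y'', φ.ψ y'' (Md.block x) * φ.θ y'' ≤ 1 := by
    rw [← hmem.2.1]
    exact Finset.sum_le_sum fun y'' _ =>
      mul_le_of_le_one_left (hmem.1 y'').le (psi_le_one hmem _ _)
  have hsum0 : 0 < ∑ y'', φ.ψ y'' (Md.block x) * φ.θ y'' :=
    Finset.sum_pos (fun y'' _ => hpos y'') ⟨y', Finset.mem_univ _⟩
  rw [responsePosterior, if_neg hx]
  calc δ * δ ≤ φ.ψ y' (Md.block x) * φ.θ y' :=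
        mul_le_mul (hψ _ _) (hθ _) hδ.le (hmem.2.2.1 _ _).le
    _ ≤ _ := le_div_self (hpos y').le hsum0 hsum

end Model

/-! ### Bounded martingale differences -/

section Martingale

variable {Ω : Type*} {m0 : MeasurableSpace Ω} {μ : Measure Ω}
  {ℱ : Filtration ℕ m0} {ξ : ℕ → Ω → ℝ} {C : ℝ}

/-- A uniformly bounded martingale difference sequence; the `j`-th difference is known at
time `j + 1` and centred given the information at time `j`. -/
structure IsBoundedMDS (μ : Measure Ω) (ℱ : Filtration ℕ m0) (ξ : ℕ → Ω → ℝ) (C : ℝ) : Prop where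
  adapted : ∀ j, StronglyMeasurable[ℱ (j + 1)] (ξ j)
  bound : ∀ j ω, |ξ j ω| ≤ C
  condExp_eq_zero : ∀ j, μ[ξ j | ℱ j] =ᵐ[μ] 0

namespace IsBoundedMDS

lemma stronglyMeasurable_of_lt (h : IsBoundedMDS μ ℱ ξ C) {j n : ℕ} (hj : j < n) :
    StronglyMeasurable[ℱ n] (ξ j) := (h.adapted j).mono (ℱ.mono hj)

lemma stronglyMeasurable (h : IsBoundedMDS μ ℱ ξ C) (j : ℕ) : StronglyMeasurable (ξ j) :=
  (h.adapted j).mono (ℱ.le _)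

lemma abs_sum_le (h : IsBoundedMDS μ ℱ ξ C) (s : Finset ℕ) (ω : Ω) :
    |∑ j ∈ s, ξ j ω| ≤ s.card * C := by
  refine (Finset.abs_sum_le_sum_abs _ _).trans ?_
  rw [← nsmul_eq_mul]
  exact Finset.sum_le_card_nsmul _ _ _ fun j _ => h.bound j ω

lemma stronglyMeasurable_sum (h : IsBoundedMDS μ ℱ ξ C) (n : ℕ) :
    StronglyMeasurable[ℱ n] fun ω => ∑ j ∈ Finset.range n, ξ j ω :=
  Finset.stronglyMeasurable_fun_sum _ fun _ hj => h.stronglyMeasurable_of_lt (Finset.mem_range.1 hj)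

variable [IsProbabilityMeasure μ]

lemma integrable (h : IsBoundedMDS μ ℱ ξ C) (j : ℕ) : Integrable (ξ j) μ :=
  .of_bound (h.stronglyMeasurable j).aestronglyMeasurable C (.of_forall (h.bound j))

lemma integral_mul_eq_zero (h : IsBoundedMDS μ ℱ ξ C) {j : ℕ} {f : Ω → ℝ}
    (hf : StronglyMeasurable[ℱ j] f) {B : ℝ} (hB : ∀ ω, |f ω| ≤ B) :
    ∫ ω, f ω * ξ j ω ∂μ = 0 := by
  have hint : Integrable (f * ξ j) μ :=
    (h.integrable j).bdd_mul (hf.mono (ℱ.le j)).aestronglyMeasurable (.of_forall hB)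
  have h1 := condExp_mul_of_stronglyMeasurable_left hf hint (h.integrable j)
  have h2 := integral_condExp (ℱ.le j) (f := f * ξ j) (μ := μ)
  rw [show ∫ ω, f ω * ξ j ω ∂μ = ∫ ω, (f * ξ j) ω ∂μ from rfl, ← h2]
  rw [integral_congr_ae (g := fun _ => (0 : ℝ)), integral_zero]
  filter_upwards [h1, h.condExp_eq_zero j] with ω h3 h4
  rw [h3, Pi.mul_apply, h4, Pi.zero_apply, mul_zero]

lemma integral_complex_mul_eq_zero (h : IsBoundedMDS μ ℱ ξ C) {j : ℕ} {f : Ω → ℂ}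
    (hf : StronglyMeasurable[ℱ j] f) {B : ℝ} (hB : ∀ ω, ‖f ω‖ ≤ B) :
    ∫ ω, f ω * ξ j ω ∂μ = 0 := by
  have hint : Integrable (fun ω => f ω * ξ j ω) μ :=
    (h.integrable j).ofReal.bdd_mul (hf.mono (ℱ.le j)).aestronglyMeasurable (.of_forall hB)
  refine Complex.ext ?_ ?_
  · have h1 := Complex.reCLM.integral_comp_comm hint
    simp only [Complex.reCLM_apply, Complex.re_mul_ofReal] at h1
    rw [← h1, Complex.zero_re]
    exact h.integral_mul_eq_zero (Complex.continuous_re.comp_stronglyMeasurable hf)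
      fun ω => (Complex.abs_re_le_norm _).trans (hB ω)
  · have h1 := Complex.imCLM.integral_comp_comm hint
    simp only [Complex.imCLM_apply, Complex.im_mul_ofReal] at h1
    rw [← h1, Complex.zero_im]
    exact h.integral_mul_eq_zero (Complex.continuous_im.comp_stronglyMeasurable hf)
      fun ω => (Complex.abs_im_le_norm _).trans (hB ω)

lemma integral_sum_sq_le (h : IsBoundedMDS μ ℱ ξ C) (n : ℕ) :
    ∫ ω, (∑ j ∈ Finset.range n, ξ j ω) ^ 2 ∂μ ≤ n * C ^ 2 := by
  induction n with
  | zero => simp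
  | succ n ih =>
    have hS := h.stronglyMeasurable_sum n
    have hSb : ∀ ω, |∑ j ∈ Finset.range n, ξ j ω| ≤ n * C := fun ω => by
      simpa using h.abs_sum_le (Finset.range n) ω
    have hS' := (hS.mono (ℱ.le n)).aestronglyMeasurable (μ := μ)
    have hξ' := (h.stronglyMeasurable n).aestronglyMeasurable (μ := μ)
    have i1 : Integrable (fun ω => (∑ j ∈ Finset.range n, ξ j ω) ^ 2) μ :=
      .of_bound (hS'.pow 2) ((n * C) ^ 2) (.of_forall fun ω => by
        rw [norm_pow]; exact pow_le_pow_left₀ (norm_nonneg _) (hSb ω) 2)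
    have i2 : Integrable (fun ω => (∑ j ∈ Finset.range n, ξ j ω) * ξ n ω) μ :=
      (h.integrable n).bdd_mul hS' (.of_forall hSb)
    have i3 : Integrable (fun ω => ξ n ω ^ 2) μ :=
      .of_bound (hξ'.pow 2) (C ^ 2) (.of_forall fun ω => by
        rw [norm_pow]; exact pow_le_pow_left₀ (norm_nonneg _) (h.bound n ω) 2)
    have h3 : ∫ ω, ξ n ω ^ 2 ∂μ ≤ C ^ 2 := by
      have : ∫ ω, ξ n ω ^ 2 ∂μ ≤ ∫ _, C ^ 2 ∂μ :=
        integral_mono i3 (integrable_const _) fun ω => sq_le_sq.2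
          ((h.bound n ω).trans (le_abs_self C))
      simpa using this
    have heq : ∀ ω, (∑ j ∈ Finset.range (n + 1), ξ j ω) ^ 2 =
        (∑ j ∈ Finset.range n, ξ j ω) ^ 2 + 2 * ((∑ j ∈ Finset.range n, ξ j ω) * ξ n ω) +
          ξ n ω ^ 2 := fun ω => by
      rw [Finset.sum_range_succ]; ring
    simp_rw [heq]
    have i12 : Integrable (fun ω => (∑ j ∈ Finset.range n, ξ j ω) ^ 2 +
        2 * ((∑ j ∈ Finset.range n, ξ j ω) * ξ n ω)) μ := i1.add (i2.const_mul 2)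
    rw [integral_add i12 i3, integral_add i1 (i2.const_mul 2),
      integral_const_mul, h.integral_mul_eq_zero hS hSb]
    push_cast
    linarith

/-- Along the squares the averages have summable second moments. -/
lemma ae_tendsto_average_sq (h : IsBoundedMDS μ ℱ ξ C) :
    ∀ᵐ ω ∂μ, Tendsto (fun k : ℕ => (∑ j ∈ Finset.range (k ^ 2), ξ j ω) / (k : ℝ) ^ 2) atTop
      (𝓝 0) := by
  set f : ℕ → Ω → ℝ := fun k ω => (∑ j ∈ Finset.range (k ^ 2), ξ j ω) / (k : ℝ) ^ 2 with hf
  have hmeas : ∀ k, Measurable (f k) := fun k =>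
    (((h.stronglyMeasurable_sum _).mono (ℱ.le _)).measurable).div_const _
  have hbd : ∀ k : ℕ, ∫⁻ ω, ENNReal.ofReal (f k ω ^ 2) ∂μ ≤
      ENNReal.ofReal (C ^ 2 * (1 / (k : ℝ) ^ 2)) := by
    intro k
    have hint : Integrable (fun ω => f k ω ^ 2) μ := by
      refine .of_bound ((hmeas k).pow_const 2).aestronglyMeasurable
        (((k ^ 2 : ℕ) * C / (k : ℝ) ^ 2) ^ 2) (.of_forall fun ω => ?_)
      rw [norm_pow]
      refine pow_le_pow_left₀ (norm_nonneg _) ?_ 2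
      rw [hf, Real.norm_eq_abs, abs_div, abs_of_nonneg (sq_nonneg (k : ℝ))]
      have := h.abs_sum_le (Finset.range (k ^ 2)) ω
      rw [Finset.card_range] at this
      gcongr
    rw [← ofReal_integral_eq_lintegral_ofReal hint (.of_forall fun ω => sq_nonneg _)]
    refine ENNReal.ofReal_le_ofReal ?_
    simp_rw [hf, div_pow]
    rw [integral_div]
    refine (div_le_div_of_nonneg_right (h.integral_sum_sq_le (k ^ 2)) (by positivity)).trans
      (le_of_eq ?_)
    rcases Nat.eq_zero_or_pos k with rfl | hk
    · simp
    · have : (k : ℝ) ≠ 0 := by positivity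
      push_cast
      field_simp
  have hsum : ∑' k, ∫⁻ ω, ENNReal.ofReal (f k ω ^ 2) ∂μ ≠ ⊤ := by
    refine ne_top_of_le_ne_top ?_ (ENNReal.tsum_le_tsum hbd)
    exact ((Real.summable_one_div_nat_pow.2 one_lt_two).mul_left (C ^ 2)).tsum_ofReal_ne_top
  rw [← lintegral_tsum fun k => ((hmeas k).pow_const 2).ennreal_ofReal.aemeasurable] at hsum
  have hfin := ae_lt_top
    (Measurable.tsum fun k => ((hmeas k).pow_const 2).ennreal_ofReal) hsum
  filter_upwards [hfin] with ω hω
  have h0 := ENNReal.tendsto_atTop_zero_of_tsum_ne_top hω.ne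
  have h1 : Tendsto (fun k => f k ω ^ 2) atTop (𝓝 0) := by
    have := (ENNReal.tendsto_toReal ENNReal.zero_ne_top).comp h0
    simpa [Function.comp_def, ENNReal.toReal_ofReal (sq_nonneg _)] using this
  have h2 : Tendsto (fun k => |f k ω|) atTop (𝓝 0) := by
    have := (Real.continuous_sqrt.tendsto 0).comp h1
    simpa [Function.comp_def, Real.sqrt_sq_eq_abs] using this
  exact (tendsto_zero_iff_abs_tendsto_zero _).2 h2

/-- The strong law of large numbers for bounded martingale differences. -/
theorem ae_tendsto_average (h : IsBoundedMDS μ ℱ ξ C) :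
    ∀ᵐ ω ∂μ, Tendsto (fun n : ℕ => (∑ j ∈ Finset.range n, ξ j ω) / (n : ℝ)) atTop (𝓝 0) := by
  filter_upwards [h.ae_tendsto_average_sq] with ω hω
  have hC : 0 ≤ C := (abs_nonneg _).trans (h.bound 0 ω)
  have hsqrt : Tendsto Nat.sqrt atTop atTop := by
    refine tendsto_atTop.2 fun b => ?_
    filter_upwards [eventually_ge_atTop (b * b)] with n hn
    exact Nat.le_sqrt.2 hn
  have hlim : Tendsto (fun n : ℕ =>
      |(∑ j ∈ Finset.range (n.sqrt ^ 2), ξ j ω) / (n.sqrt : ℝ) ^ 2| + 2 * C / (n.sqrt : ℝ))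
      atTop (𝓝 0) := by
    have h1 := (hω.abs).comp hsqrt
    have h2 := ((tendsto_natCast_atTop_atTop (R := ℝ)).comp hsqrt).const_div_atTop (2 * C)
    simpa [Function.comp_def] using h1.add h2
  refine squeeze_zero_norm' ?_ hlim
  filter_upwards [eventually_ge_atTop 1] with n hn
  have hk1 : 1 ≤ n.sqrt := Nat.le_sqrt.2 (by omega)
  have hk : (0 : ℝ) < n.sqrt := by exact_mod_cast hk1
  have hle : n.sqrt ^ 2 ≤ n := Nat.sqrt_le' n
  have hlt : n ≤ n.sqrt ^ 2 + 2 * n.sqrt := by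
    have := Nat.sqrt_le_add n
    nlinarith [this]
  -- Between consecutive squares the sum changes by at most `2 √n C`.
  have hsplit := Finset.sum_range_add_sum_Ico (fun j => ξ j ω) hle
  have hrest := h.abs_sum_le (Finset.Ico (n.sqrt ^ 2) n) ω
  rw [Nat.card_Ico] at hrest
  have hcard : ((n - n.sqrt ^ 2 : ℕ) : ℝ) ≤ 2 * n.sqrt := by
    exact_mod_cast (by omega : n - n.sqrt ^ 2 ≤ 2 * n.sqrt)
  have hn' : ((n.sqrt : ℝ)) ^ 2 ≤ n := by exact_mod_cast hle
  rw [Real.norm_eq_abs, abs_div, abs_div, abs_of_nonneg (Nat.cast_nonneg (α := ℝ) n),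
    abs_of_nonneg (sq_nonneg (n.sqrt : ℝ))]
  have h3 : |∑ j ∈ Finset.range n, ξ j ω| ≤
      |∑ j ∈ Finset.range (n.sqrt ^ 2), ξ j ω| + 2 * n.sqrt * C := by
    rw [← hsplit]
    refine (abs_add_le _ _).trans ?_
    have := mul_le_mul_of_nonneg_right hcard hC
    linarith
  calc |∑ j ∈ Finset.range n, ξ j ω| / (n : ℝ)
      ≤ (|∑ j ∈ Finset.range (n.sqrt ^ 2), ξ j ω| + 2 * n.sqrt * C) / (n.sqrt : ℝ) ^ 2 := by
        gcongr
    _ = _ := by field_simp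

end IsBoundedMDS

end Martingale

/-! ### A central limit theorem for bounded martingale differences -/

section CLT

variable {Ω : Type*} {m0 : MeasurableSpace Ω} {μ : Measure Ω}
  {ℱ : Filtration ℕ m0} {ξ : ℕ → Ω → ℝ} {C : ℝ}

/-- The logarithm of the quotient of `exp (i x)` and `1 + i x`. -/
noncomputable def mcLeishRemainder (x : ℝ) : ℂ :=
  x * Complex.I - Complex.log (1 + x * Complex.I)

lemma one_add_mul_I_ne_zero (x : ℝ) : (1 + x * Complex.I : ℂ) ≠ 0 := fun h => by
  simpa using congrArg Complex.re h

lemma exp_mul_I_eq (x : ℝ) :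
    Complex.exp (x * Complex.I) =
      (1 + x * Complex.I) * Complex.exp (mcLeishRemainder x) := by
  rw [mcLeishRemainder, Complex.exp_sub, Complex.exp_log (one_add_mul_I_ne_zero x),
    mul_div_cancel₀ _ (one_add_mul_I_ne_zero x)]

lemma norm_one_add_mul_I_sq (x : ℝ) : ‖(1 + x * Complex.I : ℂ)‖ ^ 2 = 1 + x ^ 2 := by
  rw [Complex.sq_norm, Complex.normSq_apply]
  simp
  ring

lemma one_le_norm_one_add_mul_I (x : ℝ) : 1 ≤ ‖(1 + x * Complex.I : ℂ)‖ := by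
  rw [← one_le_sq_iff₀ (norm_nonneg _), norm_one_add_mul_I_sq]
  nlinarith [sq_nonneg x]

lemma norm_one_add_mul_I_le (x : ℝ) : ‖(1 + x * Complex.I : ℂ)‖ ≤ Real.exp (x ^ 2 / 2) := by
  rw [← pow_le_pow_iff_left₀ (norm_nonneg _) (Real.exp_pos _).le two_ne_zero,
    norm_one_add_mul_I_sq, ← Real.exp_nat_mul]
  have := Real.add_one_le_exp (x ^ 2)
  convert this.trans' (le_of_eq (add_comm _ _)) using 2
  push_cast; ring

lemma norm_exp_mcLeishRemainder_le_one (x : ℝ) :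
    ‖Complex.exp (mcLeishRemainder x)‖ ≤ 1 := by
  have h := congrArg norm (exp_mul_I_eq x)
  rw [Complex.norm_exp_ofReal_mul_I, norm_mul] at h
  nlinarith [one_le_norm_one_add_mul_I x, norm_nonneg (Complex.exp (mcLeishRemainder x))]

lemma norm_mcLeishRemainder_add_le {x : ℝ} (hx : |x| ≤ 1 / 2) :
    ‖mcLeishRemainder x + (x : ℂ) ^ 2 / 2‖ ≤ |x| ^ 3 := by
  have hz : ‖(x * Complex.I : ℂ)‖ = |x| := by simp
  have h := Complex.norm_log_sub_logTaylor_le 2 (z := x * Complex.I) (by rw [hz]; linarith)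
  have ht : Complex.logTaylor 3 (x * Complex.I) = x * Complex.I + (x : ℂ) ^ 2 / 2 := by
    simp [Complex.logTaylor, Finset.sum_range_succ, mul_pow]
    ring
  rw [hz, ht] at h
  have h1 : ‖mcLeishRemainder x + (x : ℂ) ^ 2 / 2‖ =
      ‖Complex.log (1 + x * Complex.I) - (x * Complex.I + (x : ℂ) ^ 2 / 2)‖ := by
    rw [← norm_neg, mcLeishRemainder]
    congr 1
    ring
  rw [h1]
  refine h.trans ?_
  have h2 : (1 - |x|)⁻¹ ≤ 2 := by
    rw [inv_le_comm₀ (by linarith) two_pos]; linarith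
  have h3 : 0 ≤ |x| ^ 3 := by positivity
  have h4 : |x| ^ 3 * (1 - |x|)⁻¹ ≤ |x| ^ 3 * 2 := mul_le_mul_of_nonneg_left h2 h3
  norm_num
  linarith

namespace IsBoundedMDS

lemma norm_prod_one_add_le (h : IsBoundedMDS μ ℱ ξ C) (c : ℝ) (n : ℕ) (ω : Ω) :
    ‖∏ j ∈ Finset.range n, (1 + (c * ξ j ω : ℝ) * Complex.I)‖ ≤
      Real.exp (n * ((c * C) ^ 2 / 2)) := by
  rw [norm_prod, Real.exp_nat_mul]
  refine (Finset.prod_le_prod (g := fun _ => Real.exp ((c * C) ^ 2 / 2))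
    (fun _ _ => norm_nonneg _) fun j _ => ?_).trans_eq (by simp)
  refine (norm_one_add_mul_I_le _).trans (Real.exp_le_exp.2 ?_)
  have h1 : ξ j ω ^ 2 ≤ C ^ 2 := sq_le_sq.2 ((h.bound j ω).trans (le_abs_self C))
  have h2 := mul_le_mul_of_nonneg_left h1 (sq_nonneg c)
  rw [mul_pow, mul_pow]
  linarith

lemma stronglyMeasurable_prod_one_add (h : IsBoundedMDS μ ℱ ξ C) (c : ℝ) (n : ℕ) :
    StronglyMeasurable[ℱ n]
      fun ω => ∏ j ∈ Finset.range n, (1 + (c * ξ j ω : ℝ) * Complex.I) := by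
  refine Finset.stronglyMeasurable_fun_prod _ fun j hj => ?_
  have h1 := h.stronglyMeasurable_of_lt (Finset.mem_range.1 hj)
  have h2 : Continuous fun x : ℝ => (1 + (c * x : ℝ) * Complex.I) := by fun_prop
  exact h2.comp_stronglyMeasurable h1

variable [IsProbabilityMeasure μ]

lemma integral_prod_one_add (h : IsBoundedMDS μ ℱ ξ C) (c : ℝ) (n : ℕ) :
    ∫ ω, ∏ j ∈ Finset.range n, (1 + (c * ξ j ω : ℝ) * Complex.I) ∂μ = 1 := by
  induction n with
  | zero => simp
  | succ n ih =>
    have hm := h.stronglyMeasurable_prod_one_add c n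
    have hb := h.norm_prod_one_add_le c n
    have hm' := (hm.mono (ℱ.le n)).aestronglyMeasurable (μ := μ)
    have i1 := Integrable.of_bound hm' _ (.of_forall hb)
    have i2 : Integrable (fun ω =>
        (∏ j ∈ Finset.range n, (1 + (c * ξ j ω : ℝ) * Complex.I)) * (ξ n ω : ℂ)) μ :=
      (h.integrable n).ofReal.bdd_mul hm' (.of_forall hb)
    have heq : ∀ ω, ∏ j ∈ Finset.range (n + 1), (1 + (c * ξ j ω : ℝ) * Complex.I) =
        (∏ j ∈ Finset.range n, (1 + (c * ξ j ω : ℝ) * Complex.I)) + (c * Complex.I) *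
          ((∏ j ∈ Finset.range n, (1 + (c * ξ j ω : ℝ) * Complex.I)) * (ξ n ω : ℂ)) := by
      intro ω
      rw [Finset.prod_range_succ]
      push_cast
      ring
    simp_rw [heq]
    rw [integral_add i1 (i2.const_mul _), ih, integral_const_mul,
      h.integral_complex_mul_eq_zero hm hb, mul_zero, add_zero]

variable {s : ℕ → Ω → ℝ} {v : ℝ}

/-- The averages of the squares converge to the limit of the conditional variances. -/
lemma ae_tendsto_average_sq_of_condVar (h : IsBoundedMDS μ ℱ ξ C)
    (hs : ∀ j, StronglyMeasurable[ℱ j] (s j)) (hsb : ∀ j ω, |s j ω| ≤ C ^ 2)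
    (hcond : ∀ j, μ[fun ω => ξ j ω ^ 2 | ℱ j] =ᵐ[μ] s j)
    (hv : ∀ᵐ ω ∂μ, Tendsto (fun j => s j ω) atTop (𝓝 v)) :
    ∀ᵐ ω ∂μ, Tendsto (fun n : ℕ => (∑ j ∈ Finset.range n, ξ j ω ^ 2) / (n : ℝ)) atTop
      (𝓝 v) := by
  have hsq : ∀ j, StronglyMeasurable[ℱ (j + 1)] fun ω => ξ j ω ^ 2 := fun j =>
    (h.adapted j).pow 2
  have hbd : ∀ j ω, |ξ j ω ^ 2| ≤ C ^ 2 := fun j ω => by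
    rw [abs_pow]; exact pow_le_pow_left₀ (abs_nonneg _) (h.bound j ω) 2
  have hint : ∀ j, Integrable (fun ω => ξ j ω ^ 2) μ := fun j =>
    .of_bound ((hsq j).mono (ℱ.le _)).aestronglyMeasurable (C ^ 2) (.of_forall (hbd j))
  have hints : ∀ j, Integrable (s j) μ := fun j =>
    .of_bound ((hs j).mono (ℱ.le _)).aestronglyMeasurable (C ^ 2) (.of_forall (hsb j))
  have hM : IsBoundedMDS μ ℱ (fun j ω => ξ j ω ^ 2 - s j ω) (C ^ 2 + C ^ 2) := by
    refine ⟨fun j => (hsq j).sub ((hs j).mono (ℱ.mono (Nat.le_succ j))), fun j ω =>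
      (abs_sub _ _).trans (add_le_add (hbd j ω) (hsb j ω)), fun j => ?_⟩
    have h1 := condExp_sub (hint j) (hints j) (ℱ j)
    have h2 := condExp_of_stronglyMeasurable (ℱ.le j) (hs j) (hints j)
    filter_upwards [h1, hcond j] with ω h3 h4
    have h5 : (μ[(fun ω => ξ j ω ^ 2) - s j | ℱ j]) ω = 0 := by
      rw [h3, Pi.sub_apply, h4, h2, sub_self]
    exact h5
  filter_upwards [hM.ae_tendsto_average, hv] with ω h1 h2
  have h3 := h1.add h2.cesaro
  rw [zero_add] at h3
  refine h3.congr fun n => ?_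
  rw [Finset.sum_sub_distrib]
  ring

/-- The **martingale central limit theorem** for bounded differences whose conditional variances
converge to a constant, in terms of characteristic functions. Following McLeish,
`exp (i S)` is compared with the product of the factors `1 + i ξ`, which has expectation `1`. -/
theorem tendsto_integral_exp (h : IsBoundedMDS μ ℱ ξ C)
    (hs : ∀ j, StronglyMeasurable[ℱ j] (s j)) (hsb : ∀ j ω, |s j ω| ≤ C ^ 2)
    (hcond : ∀ j, μ[fun ω => ξ j ω ^ 2 | ℱ j] =ᵐ[μ] s j)
    (hv : ∀ᵐ ω ∂μ, Tendsto (fun j => s j ω) atTop (𝓝 v)) :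
    Tendsto (fun n : ℕ => ∫ ω, Complex.exp
        (((√(n : ℝ))⁻¹ * ∑ j ∈ Finset.range n, ξ j ω : ℝ) * Complex.I) ∂μ) atTop
      (𝓝 (Complex.exp (-(v / 2 : ℝ)))) := by
  set c : ℕ → ℝ := fun n => (√(n : ℝ))⁻¹ with hc
  have hc2 : ∀ n : ℕ, c n ^ 2 = (n : ℝ)⁻¹ := fun n => by
    simp only [hc, inv_pow]
    rw [Real.sq_sqrt (Nat.cast_nonneg n)]
  have hc0 : Tendsto c atTop (𝓝 0) := tendsto_inv_atTop_zero.comp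
    (Real.tendsto_sqrt_atTop.comp tendsto_natCast_atTop_atTop)
  set P : ℕ → Ω → ℂ := fun n ω =>
    ∏ j ∈ Finset.range n, (1 + (c n * ξ j ω : ℝ) * Complex.I) with hP
  set R : ℕ → Ω → ℂ := fun n ω => ∑ j ∈ Finset.range n, mcLeishRemainder (c n * ξ j ω) with hR
  have hexp : ∀ n ω, Complex.exp ((c n * ∑ j ∈ Finset.range n, ξ j ω : ℝ) * Complex.I) =
      P n ω * Complex.exp (R n ω) := by
    intro n ω
    rw [hP, hR, Complex.exp_sum, ← Finset.prod_mul_distrib, Finset.mul_sum]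
    push_cast
    rw [Finset.sum_mul, Complex.exp_sum]
    refine Finset.prod_congr rfl fun j _ => ?_
    have := exp_mul_I_eq (c n * ξ j ω)
    push_cast at this
    exact this
  have hPb : ∀ n ω, ‖P n ω‖ ≤ Real.exp (C ^ 2 / 2) := by
    intro n ω
    refine (h.norm_prod_one_add_le (c n) n ω).trans (Real.exp_le_exp.2 ?_)
    rw [mul_pow, hc2]
    rcases Nat.eq_zero_or_pos n with rfl | hn
    · simp; positivity
    · have : (n : ℝ) ≠ 0 := by positivity
      field_simp
      exact le_rfl
  -- The quotient of `exp (i S)` by the product has norm at most one, as `1 ≤ |1 + i x|`.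
  have hRb : ∀ n ω, ‖Complex.exp (R n ω)‖ ≤ 1 := by
    intro n ω
    rw [hR, Complex.exp_sum, norm_prod]
    exact Finset.prod_le_one (fun _ _ => norm_nonneg _)
      fun _ _ => norm_exp_mcLeishRemainder_le_one _
  have hPm : ∀ n, StronglyMeasurable (P n) := fun n =>
    (h.stronglyMeasurable_prod_one_add (c n) n).mono (ℱ.le n)
  have hEm : ∀ n, StronglyMeasurable fun ω =>
      Complex.exp ((c n * ∑ j ∈ Finset.range n, ξ j ω : ℝ) * Complex.I) := fun n => by
    have h1 := (h.stronglyMeasurable_sum n).mono (ℱ.le n)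
    have h2 : Continuous fun x : ℝ => Complex.exp ((c n * x : ℝ) * Complex.I) := by fun_prop
    exact h2.comp_stronglyMeasurable h1
  have hRlim : ∀ᵐ ω ∂μ, Tendsto (fun n => R n ω) atTop (𝓝 (-(v / 2 : ℝ))) := by
    filter_upwards [h.ae_tendsto_average_sq_of_condVar hs hsb hcond hv] with ω hω
    have hC : 0 ≤ C := (abs_nonneg _).trans (h.bound 0 ω)
    -- The cubic error terms add up to at most `n · (C / √n) ^ 3`.
    have h1 : Tendsto (fun n => R n ω +
        (((∑ j ∈ Finset.range n, ξ j ω ^ 2) / (n : ℝ) / 2 : ℝ) : ℂ)) atTop (𝓝 0) := by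
      have hlim : Tendsto (fun n => c n * C ^ 3) atTop (𝓝 0) := by
        simpa using hc0.mul_const (C ^ 3)
      refine squeeze_zero_norm' ?_ hlim
      have hsmall : ∀ᶠ n in atTop, c n * C < 1 / 2 := by
        have h2 := hc0.mul_const C
        rw [zero_mul] at h2
        exact h2.eventually_lt_const (by norm_num)
      filter_upwards [hsmall, eventually_gt_atTop 0] with n hn hn0
      have hcn : 0 ≤ c n := inv_nonneg.2 (Real.sqrt_nonneg _)
      have hx : ∀ j, |c n * ξ j ω| ≤ c n * C := fun j => by
        rw [abs_mul, abs_of_nonneg hcn]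
        exact mul_le_mul_of_nonneg_left (h.bound j ω) hcn
      have heq : R n ω + (((∑ j ∈ Finset.range n, ξ j ω ^ 2) / (n : ℝ) / 2 : ℝ) : ℂ) =
          ∑ j ∈ Finset.range n,
            (mcLeishRemainder (c n * ξ j ω) + ((c n * ξ j ω : ℝ) : ℂ) ^ 2 / 2) := by
        rw [Finset.sum_add_distrib]
        congr 1
        rw [Finset.sum_div, Finset.sum_div, Complex.ofReal_sum]
        refine Finset.sum_congr rfl fun j _ => ?_
        rw [← Complex.ofReal_pow, mul_pow, hc2]
        push_cast
        ring
      rw [heq]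
      refine (norm_sum_le_of_le _ fun j _ =>
        (norm_mcLeishRemainder_add_le ((hx j).trans hn.le)).trans
          (pow_le_pow_left₀ (abs_nonneg _) (hx j) 3)).trans (le_of_eq ?_)
      rw [Finset.sum_const, Finset.card_range, nsmul_eq_mul, mul_pow, pow_succ (c n) 2, hc2]
      have : (n : ℝ) ≠ 0 := by positivity
      field_simp
    have h2 : Tendsto (fun n : ℕ => (((∑ j ∈ Finset.range n, ξ j ω ^ 2) / (n : ℝ) / 2 : ℝ) : ℂ))
        atTop (𝓝 ((v / 2 : ℝ) : ℂ)) :=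
      (Complex.continuous_ofReal.tendsto _).comp (hω.div_const 2)
    have h3 := h1.sub h2
    simpa using h3
  -- Since the product has expectation one, subtracting the limit inside the integral is free.
  have hmain : Tendsto (fun n => ∫ ω, P n ω *
      (Complex.exp (R n ω) - Complex.exp (-(v / 2 : ℝ))) ∂μ) atTop (𝓝 0) := by
    have hD := tendsto_integral_of_dominated_convergence (μ := μ) (F := fun n ω => P n ω *
      (Complex.exp (R n ω) - Complex.exp (-(v / 2 : ℝ)))) (f := fun _ => 0)
      (fun _ => Real.exp (C ^ 2 / 2) * (1 + ‖Complex.exp (-(v / 2 : ℝ))‖)) ?_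
      (integrable_const _) ?_ ?_
    · simpa using hD
    · intro n
      have : (fun ω => P n ω * (Complex.exp (R n ω) - Complex.exp (-(v / 2 : ℝ)))) =
          fun ω => Complex.exp ((c n * ∑ j ∈ Finset.range n, ξ j ω : ℝ) * Complex.I) -
            P n ω * Complex.exp (-(v / 2 : ℝ)) := by
        funext ω; rw [mul_sub, hexp]
      rw [this]
      exact ((hEm n).sub ((hPm n).mul_const _)).aestronglyMeasurable
    · intro n
      refine .of_forall fun ω => ?_
      rw [norm_mul]
      gcongr
      · exact hPb n ω
      · exact (norm_sub_le _ _).trans (add_le_add_left (hRb n ω) _)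
    · filter_upwards [hRlim] with ω hω
      have h1 : Tendsto (fun n => Complex.exp (R n ω) - Complex.exp (-(v / 2 : ℝ))) atTop
          (𝓝 0) := by
        have := ((Complex.continuous_exp.tendsto _).comp hω).sub_const
          (Complex.exp (-(v / 2 : ℝ)))
        simpa using this
      have h2 : Tendsto (fun n => Real.exp (C ^ 2 / 2) *
          ‖Complex.exp (R n ω) - Complex.exp (-(v / 2 : ℝ))‖) atTop (𝓝 0) := by
        simpa using h1.norm.const_mul (Real.exp (C ^ 2 / 2))
      refine squeeze_zero_norm (fun n => ?_) h2
      rw [norm_mul]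
      exact mul_le_mul_of_nonneg_right (hPb n ω) (norm_nonneg _)
  have hfin : ∀ n : ℕ, ∫ ω, Complex.exp
      ((c n * ∑ j ∈ Finset.range n, ξ j ω : ℝ) * Complex.I) ∂μ =
      ∫ ω, P n ω * (Complex.exp (R n ω) - Complex.exp (-(v / 2 : ℝ))) ∂μ +
        Complex.exp (-(v / 2 : ℝ)) := by
    intro n
    have iE : Integrable (fun ω => Complex.exp
        ((c n * ∑ j ∈ Finset.range n, ξ j ω : ℝ) * Complex.I)) μ :=
      .of_bound (hEm n).aestronglyMeasurable 1
        (.of_forall fun ω => (Complex.norm_exp_ofReal_mul_I _).le)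
    have iP : Integrable (P n) μ :=
      .of_bound (hPm n).aestronglyMeasurable _ (.of_forall (hPb n))
    simp_rw [mul_sub, ← hexp]
    rw [integral_sub iE (iP.mul_const _), integral_mul_const,
      h.integral_prod_one_add (c n) n, one_mul, sub_add_cancel]
  have hadd := hmain.add_const (Complex.exp (-(v / 2 : ℝ)))
  rw [zero_add] at hadd
  exact hadd.congr fun n => (hfin n).symm

end IsBoundedMDS

end CLT

/-! ### Gaussian limits and the delta method -/

section DeltaMethod

variable {d m : ℕ}

lemma fderiv_apply_eq_jacobian_mulVec
    (g : EuclideanSpace ℝ (Fin d) → EuclideanSpace ℝ (Fin m)) (r z : EuclideanSpace ℝ (Fin d))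
    (i : Fin m) : fderiv ℝ g r z i = (jacobian g r).mulVec z.ofLp i := by
  have hz : z = ∑ j, z j • EuclideanSpace.single j (1 : ℝ) := by
    simpa using ((EuclideanSpace.basisFun (Fin d) ℝ).sum_repr z).symm
  conv_lhs => rw [hz, map_sum]
  simp [jacobian, Matrix.mulVec, dotProduct, mul_comm]

lemma inner_fderiv_eq (g : EuclideanSpace ℝ (Fin d) → EuclideanSpace ℝ (Fin m))
    (r z : EuclideanSpace ℝ (Fin d)) (u : EuclideanSpace ℝ (Fin m)) :
    inner ℝ (fderiv ℝ g r z) u =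
      inner ℝ z (WithLp.toLp 2 ((jacobian g r).transpose.mulVec u.ofLp)) := by
  have h1 : (fderiv ℝ g r z).ofLp = (jacobian g r).mulVec z.ofLp :=
    funext fun i => fderiv_apply_eq_jacobian_mulVec g r z i
  rw [EuclideanSpace.inner_eq_star_dotProduct, EuclideanSpace.inner_eq_star_dotProduct]
  simp only [star_trivial]
  rw [h1, Matrix.dotProduct_mulVec, Matrix.mulVec_transpose]

/-- The image of a centred Gaussian law under the derivative of `g`. -/
lemma map_fderiv_multivariateGaussian
    (g : EuclideanSpace ℝ (Fin d) → EuclideanSpace ℝ (Fin m)) (r : EuclideanSpace ℝ (Fin d))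
    {V : Matrix (Fin d) (Fin d) ℝ} (hV : V.PosSemidef) :
    (multivariateGaussian 0 V).map (fderiv ℝ g r) =
      multivariateGaussian 0 (jacobian g r * V * (jacobian g r).transpose) := by
  have hW : (jacobian g r * V * (jacobian g r).transpose).PosSemidef := by
    simpa using hV.mul_mul_conjTranspose_same (jacobian g r)
  have : IsProbabilityMeasure ((multivariateGaussian 0 V).map (fderiv ℝ g r)) :=
    Measure.isProbabilityMeasure_map (by fun_prop)
  refine Measure.ext_of_charFun (funext fun u => ?_)
  have h1 : charFun ((multivariateGaussian 0 V).map (fderiv ℝ g r)) u =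
      charFun (multivariateGaussian 0 V)
        (WithLp.toLp 2 ((jacobian g r).transpose.mulVec u.ofLp)) := by
    rw [charFun_apply, charFun_apply, integral_map (by fun_prop) (by fun_prop)]
    simp_rw [inner_fderiv_eq]
  rw [h1, charFun_multivariateGaussian hV, charFun_multivariateGaussian hW]
  congr 3
  · simp
  · congr 1
    rw [← Matrix.mulVec_mulVec, ← Matrix.mulVec_mulVec, Matrix.dotProduct_mulVec,
      Matrix.dotProduct_mulVec _ (jacobian g r), Matrix.dotProduct_mulVec _ V,
      Matrix.mulVec_transpose]

variable {Ω : Type*} [MeasurableSpace Ω] {μ : Measure Ω} [IsProbabilityMeasure μ]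

/-- The Cramér–Wold device for a Gaussian limit. -/
lemma tendstoInDistribution_multivariateGaussian {V : Matrix (Fin d) (Fin d) ℝ}
    (hV : V.PosSemidef) {T : ℕ → Ω → EuclideanSpace ℝ (Fin d)} (hT : ∀ n, Measurable (T n))
    (h : ∀ u : EuclideanSpace ℝ (Fin d), Tendsto (fun n => ∫ ω, Complex.exp
        ((inner ℝ (T n ω) u : ℝ) * Complex.I) ∂μ) atTop
      (𝓝 (Complex.exp (-((u.ofLp ⬝ᵥ V.mulVec u.ofLp) / 2 : ℝ))))) :
    TendstoInDistribution T atTop id (fun _ => μ) (multivariateGaussian 0 V) where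
  forall_aemeasurable n := (hT n).aemeasurable
  aemeasurable_limit := aemeasurable_id
  tendsto := by
    refine ProbabilityMeasure.tendsto_iff_tendsto_charFun.2 fun u => ?_
    have h1 : charFun ((multivariateGaussian 0 V).map id) u =
        Complex.exp (-((u.ofLp ⬝ᵥ V.mulVec u.ofLp) / 2 : ℝ)) := by
      rw [Measure.map_id, charFun_multivariateGaussian hV]
      congr 1
      simp
    have h2 : ∀ n, charFun (μ.map (T n)) u =
        ∫ ω, Complex.exp ((inner ℝ (T n ω) u : ℝ) * Complex.I) ∂μ := fun n => by
      rw [charFun_apply, integral_map (hT n).aemeasurable (by fun_prop)]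
    simp only [ProbabilityMeasure.coe_mk]
    rw [h1]
    simp_rw [h2]
    exact h u

/-- The **delta method** for a Gaussian limit: the remainder of the linearization is
`‖√n (R̂ n - r)‖` times a vector that tends to zero, and the limit passes through the continuous
map `(z, e) ↦ D z + ‖z‖ e` by Slutsky's theorem. -/
lemma tendstoInDistribution_delta {V : Matrix (Fin d) (Fin d) ℝ} (hV : V.PosSemidef)
    {g : EuclideanSpace ℝ (Fin d) → EuclideanSpace ℝ (Fin m)} {r : EuclideanSpace ℝ (Fin d)}
    (hg : DifferentiableAt ℝ g r) {R : ℕ → Ω → EuclideanSpace ℝ (Fin d)}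
    (hR : ∀ n, Measurable (R n)) (hgR : ∀ n, Measurable fun ω => g (R n ω))
    (hlim : ∀ᵐ ω ∂μ, Tendsto (fun n => R n ω) atTop (𝓝 r))
    (h : TendstoInDistribution (fun (n : ℕ) ω => √(n : ℝ) • (R n ω - r)) atTop id (fun _ => μ)
      (multivariateGaussian 0 V)) :
    TendstoInDistribution (fun (n : ℕ) ω => √(n : ℝ) • (g (R n ω) - g r)) atTop id (fun _ => μ)
      (multivariateGaussian 0 (jacobian g r * V * (jacobian g r).transpose)) := by
  set D := fderiv ℝ g r with hD
  set e : ℕ → Ω → EuclideanSpace ℝ (Fin m) := fun n ω =>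
    ‖R n ω - r‖⁻¹ • (g (R n ω) - g r - D (R n ω - r)) with he
  have hem : ∀ n, Measurable (e n) := fun n =>
    ((hR n).sub_const r).norm.inv.smul
      (((hgR n).sub_const _).sub (D.measurable.comp ((hR n).sub_const r)))
  -- Where `R n ω = r` the inverse norm is `0⁻¹ = 0`, which is harmless: the remainder vanishes.
  have he0 : ∀ᵐ ω ∂μ, Tendsto (fun n => e n ω) atTop (𝓝 0) := by
    filter_upwards [hlim] with ω hω
    have h1 := hg.hasFDerivAt.isLittleO.comp_tendsto hω
    have h2 := h1.norm_right.tendsto_inv_smul_nhds_zero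
    exact h2
  have heP : TendstoInMeasure μ e atTop (fun _ => 0) :=
    tendstoInMeasure_of_tendsto_ae (fun n => (hem n).aestronglyMeasurable) he0
  have hS := h.continuous_comp_prodMk_of_tendstoInMeasure_const
    (g := fun z : EuclideanSpace ℝ (Fin d) × EuclideanSpace ℝ (Fin m) => D z.1 + ‖z.1‖ • z.2)
    (by fun_prop) heP fun n => (hem n).aemeasurable
  have heq : ∀ (n : ℕ) ω, D (√(n : ℝ) • (R n ω - r)) + ‖√(n : ℝ) • (R n ω - r)‖ • e n ω =
      √(n : ℝ) • (g (R n ω) - g r) := by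
    intro n ω
    rw [norm_smul, Real.norm_of_nonneg (Real.sqrt_nonneg _), map_smul, mul_smul, ← smul_add, he]
    congr 1
    by_cases h0 : R n ω - r = 0
    · have h0' : R n ω = r := sub_eq_zero.1 h0
      simp [h0']
    · simp only []
      rw [smul_inv_smul₀ (norm_ne_zero_iff.2 h0)]
      abel
  simp only [heq, id, smul_zero, add_zero] at hS
  refine ⟨hS.forall_aemeasurable, aemeasurable_id, ?_⟩
  convert hS.tendsto using 2
  congr 1
  refine Subtype.ext ?_
  change Measure.map id _ = Measure.map (fun z => D z) _
  rw [Measure.map_id, ← map_fderiv_multivariateGaussian g r hV]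

end DeltaMethod

/-! ### The variance of importance sampling with a fixed proposal -/

section FixedProposal

variable {X Y : Type*} [Fintype X] {d m : ℕ} {p : X → ℝ}
  {ℓ : X → Y → EuclideanSpace ℝ (Fin d)}
  {g : EuclideanSpace ℝ (Fin d) → EuclideanSpace ℝ (Fin m)} {y : X → Y} {q : X → ℝ}

/-- The centred contribution `(p(x)/q(x)) ℓ(x, y(x)) - R` of an instance `x` drawn from `q`. -/
noncomputable def contribution (p : X → ℝ) (ℓ : X → Y → EuclideanSpace ℝ (Fin d)) (y : X → Y)
    (q : X → ℝ) (x : X) : EuclideanSpace ℝ (Fin d) := (p x / q x) • ℓ x (y x) - risk p ℓ y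

lemma sum_smul_weighted (hq : ∀ x, ℓ x (y x) ≠ 0 → q x ≠ 0) :
    ∑ x, q x • (p x / q x) • ℓ x (y x) = risk p ℓ y := by
  refine Finset.sum_congr rfl fun x _ => ?_
  by_cases h : ℓ x (y x) = 0
  · simp [h]
  · rw [smul_smul, mul_div_cancel₀ _ (hq x h)]

lemma sum_smul_contribution (hq1 : ∑ x, q x = 1) (hq : ∀ x, ℓ x (y x) ≠ 0 → q x ≠ 0) :
    ∑ x, q x • contribution p ℓ y q x = 0 := by
  simp_rw [contribution, smul_sub, Finset.sum_sub_distrib, sum_smul_weighted hq,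
    ← Finset.sum_smul, hq1, one_smul, sub_self]

lemma proposalCov_apply (a b : Fin d) :
    proposalCov p ℓ y q a b =
      ∑ x, q x * (contribution p ℓ y q x a * contribution p ℓ y q x b) := rfl

lemma dotProduct_proposalCov_mulVec (u : Fin d → ℝ) :
    u ⬝ᵥ (proposalCov p ℓ y q).mulVec u =
      ∑ x, q x * (u ⬝ᵥ (contribution p ℓ y q x).ofLp) ^ 2 := by
  simp_rw [dotProduct, Matrix.mulVec, dotProduct, proposalCov_apply, Finset.sum_mul,
    Finset.mul_sum, sq, Finset.sum_mul_sum, Finset.mul_sum]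
  rw [Finset.sum_comm_cycle]
  refine Finset.sum_congr rfl fun x _ => Finset.sum_congr rfl fun a _ =>
    Finset.sum_congr rfl fun b _ => ?_
  ring

lemma proposalCov_posSemidef (hq : ∀ x, 0 ≤ q x) : (proposalCov p ℓ y q).PosSemidef := by
  refine Matrix.PosSemidef.of_dotProduct_mulVec_nonneg ?_ fun u => ?_
  · ext a b
    simp only [Matrix.conjTranspose_apply, star_trivial, proposalCov_apply]
    exact Finset.sum_congr rfl fun x _ => by ring
  · rw [star_trivial, dotProduct_proposalCov_mulVec]
    exact Finset.sum_nonneg fun x _ => mul_nonneg (hq x) (sq_nonneg _)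

lemma trace_deltaCov_proposalCov (q : X → ℝ) :
    (deltaCov p ℓ g y (proposalCov p ℓ y q)).trace =
      ∑ x, q x * ‖fderiv ℝ g (risk p ℓ y) (contribution p ℓ y q x)‖ ^ 2 := by
  have hrow : ∀ i, deltaCov p ℓ g y (proposalCov p ℓ y q) i i =
      ∑ x, q x * (fderiv ℝ g (risk p ℓ y) (contribution p ℓ y q x) i) ^ 2 := by
    intro i
    have h1 : deltaCov p ℓ g y (proposalCov p ℓ y q) i i =
        (jacobian g (risk p ℓ y)).row i ⬝ᵥ
          (proposalCov p ℓ y q).mulVec ((jacobian g (risk p ℓ y)).row i) := by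
      rw [deltaCov, Matrix.mul_assoc, Matrix.mul_apply_eq_vecMul, Matrix.vecMul, dotProduct,
        dotProduct]
      rfl
    rw [h1, dotProduct_proposalCov_mulVec]
    refine Finset.sum_congr rfl fun x _ => ?_
    rw [fderiv_apply_eq_jacobian_mulVec]
    rfl
  simp_rw [Matrix.trace, Matrix.diag_apply, hrow, EuclideanSpace.norm_sq_eq, Real.norm_eq_abs,
    sq_abs, Finset.mul_sum]
  exact Finset.sum_comm

/-- The total asymptotic variance is a second moment minus `‖D_g(R) R‖²`. -/
lemma trace_deltaCov_eq_sub (hq1 : ∑ x, q x = 1) (hq : ∀ x, ℓ x (y x) ≠ 0 → q x ≠ 0) :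
    (deltaCov p ℓ g y (proposalCov p ℓ y q)).trace =
      ∑ x, q x * ((p x / q x) ^ 2 * ‖fderiv ℝ g (risk p ℓ y) (ℓ x (y x))‖ ^ 2) -
        ‖fderiv ℝ g (risk p ℓ y) (risk p ℓ y)‖ ^ 2 := by
  rw [trace_deltaCov_proposalCov]
  set D := fderiv ℝ g (risk p ℓ y)
  set z := D (risk p ℓ y) with hz
  have hexp : ∀ x, q x * ‖D (contribution p ℓ y q x)‖ ^ 2 =
      q x * ((p x / q x) ^ 2 * ‖D (ℓ x (y x))‖ ^ 2) -
        2 * inner ℝ (q x • (p x / q x) • D (ℓ x (y x))) z + q x * ‖z‖ ^ 2 := by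
    intro x
    rw [contribution, map_sub, map_smul, norm_sub_sq_real, norm_smul, mul_pow, Real.norm_eq_abs,
      sq_abs, real_inner_smul_left _ _ (q x)]
    ring
  have hmean : ∑ x, q x • (p x / q x) • D (ℓ x (y x)) = z := by
    rw [hz]
    conv_rhs => rw [← sum_smul_weighted hq]
    simp [map_sum, map_smul]
  simp_rw [hexp]
  rw [Finset.sum_add_distrib, Finset.sum_sub_distrib, ← Finset.mul_sum, ← sum_inner, hmean,
    ← Finset.sum_mul, hq1, real_inner_self_eq_norm_sq]
  ring

lemma optWeight_nonneg (hp : ∀ x, 0 < p x) (x : X) : 0 ≤ optWeight p ℓ g y x :=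
  mul_nonneg (hp x).le (norm_nonneg _)

/-- The Cauchy–Schwarz inequality behind the optimality of `q⋆`. -/
lemma sq_sum_optWeight_le (hq0 : ∀ x, 0 ≤ q x) (hq1 : ∑ x, q x = 1)
    (hq : ∀ x, ℓ x (y x) ≠ 0 → q x ≠ 0) :
    (∑ x, optWeight p ℓ g y x) ^ 2 ≤
      ∑ x, q x * ((p x / q x) ^ 2 * ‖fderiv ℝ g (risk p ℓ y) (ℓ x (y x))‖ ^ 2) := by
  have h := Finset.sum_sq_le_sum_mul_sum_of_sq_le_mul Finset.univ
    (r := fun x => optWeight p ℓ g y x) (f := q)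
    (g := fun x => q x * ((p x / q x) ^ 2 * ‖fderiv ℝ g (risk p ℓ y) (ℓ x (y x))‖ ^ 2))
    (fun x _ => hq0 x)
    (fun x _ => mul_nonneg (hq0 x) (mul_nonneg (sq_nonneg _) (sq_nonneg _))) fun x _ => by
      refine le_of_eq ?_
      by_cases h : ℓ x (y x) = 0
      · simp [optWeight, h]
      · have := hq x h
        rw [optWeight]
        field_simp
  rwa [hq1, one_mul] at h

lemma sum_optProposal (hv : ∑ x, optWeight p ℓ g y x ≠ 0) :
    ∑ x, optProposal p ℓ g y x = 1 := by
  simp_rw [optProposal, ← Finset.sum_div]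
  exact div_self hv

lemma optProposal_nonneg (hp : ∀ x, 0 < p x) (x : X) : 0 ≤ optProposal p ℓ g y x :=
  div_nonneg (optWeight_nonneg hp x) (Finset.sum_nonneg fun x _ => optWeight_nonneg hp x)

lemma sum_optWeight_pos (hp : ∀ x, 0 < p x) (hne : ∃ x, ℓ x (y x) ≠ 0)
    (hnd : ∀ x, ℓ x (y x) ≠ 0 → fderiv ℝ g (risk p ℓ y) (ℓ x (y x)) ≠ 0) :
    0 < ∑ x, optWeight p ℓ g y x := by
  obtain ⟨x, hx⟩ := hne
  exact Finset.sum_pos' (fun x _ => optWeight_nonneg hp x)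
    ⟨x, Finset.mem_univ x, mul_pos (hp x) (norm_pos_iff.2 (hnd x hx))⟩

lemma optProposal_pos (hp : ∀ x, 0 < p x)
    (hnd : ∀ x, ℓ x (y x) ≠ 0 → fderiv ℝ g (risk p ℓ y) (ℓ x (y x)) ≠ 0) {x : X}
    (hx : ℓ x (y x) ≠ 0) : 0 < optProposal p ℓ g y x :=
  div_pos (mul_pos (hp x) (norm_pos_iff.2 (hnd x hx))) (sum_optWeight_pos hp ⟨x, hx⟩ hnd)

lemma trace_deltaCov_optProposal (hp : ∀ x, 0 < p x) (hne : ∃ x, ℓ x (y x) ≠ 0)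
    (hnd : ∀ x, ℓ x (y x) ≠ 0 → fderiv ℝ g (risk p ℓ y) (ℓ x (y x)) ≠ 0) :
    (deltaCov p ℓ g y (proposalCov p ℓ y (optProposal p ℓ g y))).trace =
      (∑ x, optWeight p ℓ g y x) ^ 2 - ‖fderiv ℝ g (risk p ℓ y) (risk p ℓ y)‖ ^ 2 := by
  have hv := (sum_optWeight_pos hp hne hnd).ne'
  rw [trace_deltaCov_eq_sub (sum_optProposal hv) fun x hx => (optProposal_pos hp hnd hx).ne']
  congr 1
  rw [sq, Finset.sum_mul]
  refine Finset.sum_congr rfl fun x _ => ?_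
  by_cases h : ℓ x (y x) = 0
  · simp [optWeight, h]
  · have h1 := (hp x).ne'
    have h2 := norm_ne_zero_iff.2 (hnd x h)
    rw [optProposal]
    set s := ∑ x', optWeight p ℓ g y x'
    rw [optWeight]
    field_simp

/-- The proposal `q⋆` minimizes the total asymptotic variance (Cauchy–Schwarz). -/
lemma isLeast_trace_deltaCov (hp : ∀ x, 0 < p x) (hne : ∃ x, ℓ x (y x) ≠ 0)
    (hnd : ∀ x, ℓ x (y x) ≠ 0 → fderiv ℝ g (risk p ℓ y) (ℓ x (y x)) ≠ 0) :
    IsLeast {s : ℝ | ∃ q' : X → ℝ, IsPmf q' ∧ HasSupport p ℓ y q' ∧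
        s = (deltaCov p ℓ g y (proposalCov p ℓ y q')).trace}
      (deltaCov p ℓ g y (proposalCov p ℓ y (optProposal p ℓ g y))).trace := by
  refine ⟨⟨optProposal p ℓ g y, ⟨optProposal_nonneg hp,
    sum_optProposal (sum_optWeight_pos hp hne hnd).ne'⟩, fun x hx => ?_, rfl⟩, ?_⟩
  · exact optProposal_pos hp hnd (norm_ne_zero_iff.1 (left_ne_zero_of_mul hx))
  · rintro s ⟨q', ⟨hq0, hq1⟩, hsupp, rfl⟩
    have hq : ∀ x, ℓ x (y x) ≠ 0 → q' x ≠ 0 := fun x hx =>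
      (hsupp x (mul_ne_zero (norm_ne_zero_iff.2 hx) (hp x).ne')).ne'
    rw [trace_deltaCov_optProposal hp hne hnd, trace_deltaCov_eq_sub hq1 hq]
    exact sub_le_sub_right (sq_sum_optWeight_le hq0 hq1 hq) _

end FixedProposal

/-! ### The proposal weights -/

section Weights

variable {X Y : Type*} {d m : ℕ} {p : X → ℝ}
  {ℓ : X → Y → EuclideanSpace ℝ (Fin d)}
  {g : EuclideanSpace ℝ (Fin d) → EuclideanSpace ℝ (Fin m)} {y : X → Y}
  {r : EuclideanSpace ℝ (Fin d)} {ε ε₀ : ℝ}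

lemma epsilon_nonneg [Fintype X] (hε₀ : 0 < ε₀) (O : Finset X) : 0 ≤ epsilon ε₀ O := by
  refine mul_nonneg hε₀.le (sub_nonneg.2 (div_le_one_of_le₀ ?_ (Nat.cast_nonneg _)))
  exact_mod_cast O.card_le_univ

lemma epsilon_le [Fintype X] (hε₀ : 0 < ε₀) (O : Finset X) : epsilon ε₀ O ≤ ε₀ :=
  mul_le_of_le_one_right hε₀.le (sub_le_self _ (by positivity))

lemma le_epsilon [Fintype X] (hε₀ : 0 < ε₀) {O : Finset X} (hO : O ≠ Finset.univ) :
    ε₀ / Fintype.card X ≤ epsilon ε₀ O := by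
  have h1 : O.card + 1 ≤ Fintype.card X := (Finset.card_lt_iff_ne_univ O).2 hO
  have h2 : (O.card : ℝ) + 1 ≤ Fintype.card X := by exact_mod_cast h1
  have h3 : (0 : ℝ) < Fintype.card X := by
    have := Nat.cast_nonneg (α := ℝ) O.card
    linarith
  rw [epsilon, div_eq_mul_one_div]
  refine mul_le_mul_of_nonneg_left ?_ hε₀.le
  rw [div_le_iff₀ h3, sub_mul, div_mul_cancel₀ _ h3.ne']
  linarith

lemma epsilon_pos [Fintype X] (hε₀ : 0 < ε₀) {O : Finset X} (hO : O ≠ Finset.univ) :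
    0 < epsilon ε₀ O := by
  have h1 : 0 < Fintype.card X := by
    have := (Finset.card_lt_iff_ne_univ O).2 hO
    omega
  exact (div_pos hε₀ (by exact_mod_cast h1)).trans_le (le_epsilon hε₀ hO)

lemma epsilon_univ [Fintype X] [Nonempty X] : epsilon ε₀ (Finset.univ : Finset X) = 0 := by
  simp [epsilon]

open Classical in
/-- The weight of an instance whose label is known. -/
noncomputable def labelledWeight (p : X → ℝ) (ℓ : X → Y → EuclideanSpace ℝ (Fin d))
    (g : EuclideanSpace ℝ (Fin d) → EuclideanSpace ℝ (Fin m)) (y : X → Y)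
    (r : EuclideanSpace ℝ (Fin d)) (ε : ℝ) (x : X) : ℝ :=
  p x * max ‖fderiv ℝ g r (ℓ x (y x))‖ (ε * if ‖ℓ x (y x)‖ ≠ 0 then 1 else 0)

lemma labelledWeight_nonneg (hp : ∀ x, 0 < p x) (x : X) : 0 ≤ labelledWeight p ℓ g y r ε x :=
  mul_nonneg (hp x).le ((norm_nonneg _).trans (le_max_left _ _))

lemma labelledWeight_eq_zero {x : X} (h : ℓ x (y x) = 0) :
    labelledWeight p ℓ g y r ε x = 0 := by
  simp [labelledWeight, h]

lemma labelledWeight_pos (hp : ∀ x, 0 < p x) {x : X} (h : ℓ x (y x) ≠ 0)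
    (h' : 0 < ε ∨ fderiv ℝ g r (ℓ x (y x)) ≠ 0) : 0 < labelledWeight p ℓ g y r ε x := by
  refine mul_pos (hp x) (lt_max_iff.2 ?_)
  rcases h' with h' | h'
  · right
    simpa [h] using h'
  · exact Or.inl (norm_pos_iff.2 h')

lemma labelledWeight_zero [Fintype X] (x : X) :
    labelledWeight p ℓ g y (risk p ℓ y) 0 x = optWeight p ℓ g y x := by
  simp [labelledWeight, optWeight]

lemma tendsto_labelledWeight {R : ℕ → EuclideanSpace ℝ (Fin d)} (hR : Tendsto R atTop (𝓝 r))
    (hDg : ContinuousAt (fderiv ℝ g) r) (ε : ℝ) (x : X) :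
    Tendsto (fun t => labelledWeight p ℓ g y (R t) ε x) atTop
      (𝓝 (labelledWeight p ℓ g y r ε x)) := by
  have h1 : Tendsto (fun t => fderiv ℝ g (R t) (ℓ x (y x))) atTop
      (𝓝 (fderiv ℝ g r (ℓ x (y x)))) :=
    ((ContinuousLinearMap.apply ℝ _ (ℓ x (y x))).continuous.tendsto _).comp
      (hDg.tendsto.comp hR)
  exact (h1.norm.max tendsto_const_nhds).const_mul _

variable [Fintype Y] {π : X → Y → ℝ}

lemma proposalWeight_nonneg (hp : ∀ x, 0 < p x) (hπ : ∀ x y', 0 ≤ π x y') (x : X) :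
    0 ≤ proposalWeight p ℓ g r ε π x :=
  mul_nonneg (hp x).le (Finset.sum_nonneg fun y' _ =>
    mul_nonneg ((norm_nonneg _).trans (le_max_left _ _)) (hπ x y'))

lemma proposalWeight_eq_zero {x : X} (h : ∀ y', ℓ x y' = 0) :
    proposalWeight p ℓ g r ε π x = 0 := by
  simp [proposalWeight, h]

lemma le_proposalWeight (hp : ∀ x, 0 < p x) (hπ : ∀ x y', 0 ≤ π x y') (hε : 0 ≤ ε) {δ : ℝ}
    {x : X} {y' : Y} (hδ : δ ≤ π x y') (h : ℓ x y' ≠ 0) :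
    p x * (ε * δ) ≤ proposalWeight p ℓ g r ε π x := by
  classical
  have hnn : ∀ y'', 0 ≤ max ‖fderiv ℝ g r (ℓ x y'')‖ (ε * if ‖ℓ x y''‖ ≠ 0 then 1 else 0) :=
    fun y'' => (norm_nonneg _).trans (le_max_left _ _)
  refine mul_le_mul_of_nonneg_left ?_ (hp x).le
  have h1 := Finset.single_le_sum (f := fun y'' =>
    max ‖fderiv ℝ g r (ℓ x y'')‖ (ε * if ‖ℓ x y''‖ ≠ 0 then 1 else 0) * π x y'')
    (fun y'' _ => mul_nonneg (hnn y'') (hπ x y'')) (Finset.mem_univ y')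
  refine le_trans ?_ (h1.trans_eq ?_)
  · refine (mul_le_mul_of_nonneg_left hδ hε).trans (mul_le_mul_of_nonneg_right ?_ (hπ x y'))
    refine le_max_of_le_right ?_
    simp [h]
  · exact Finset.sum_congr rfl fun y'' _ => by congr

lemma proposalWeight_le (hp : ∀ x, 0 < p x)
    (hπ1 : ∀ x y', π x y' ≤ 1) (hε : 0 ≤ ε) (hε₀ : ε ≤ ε₀) {K : ℝ} (hK : ‖fderiv ℝ g r‖ ≤ K)
    (x : X) :
    proposalWeight p ℓ g r ε π x ≤ p x * ∑ y', (K * ‖ℓ x y'‖ + ε₀) := by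
  have hK0 : 0 ≤ K := (norm_nonneg _).trans hK
  refine mul_le_mul_of_nonneg_left (Finset.sum_le_sum fun y' _ => ?_) (hp x).le
  have h1 : ‖fderiv ℝ g r (ℓ x y')‖ ≤ K * ‖ℓ x y'‖ :=
    (ContinuousLinearMap.le_opNorm _ _).trans (mul_le_mul_of_nonneg_right hK (norm_nonneg _))
  have h2 : 0 ≤ K * ‖ℓ x y'‖ := mul_nonneg hK0 (norm_nonneg _)
  refine (mul_le_of_le_one_right ((norm_nonneg _).trans (le_max_left _ _)) (hπ1 x y')).trans
    (max_le (by linarith) ?_)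
  split_ifs
  · linarith
  · linarith

open Classical in
lemma proposalWeight_of_mem {V : Type*} {Md : Model V X Y} (φ : Md.Params) {O : Finset X} {x : X}
    (hx : x ∈ O) :
    proposalWeight p ℓ g r ε (Model.responsePosterior φ y O) x =
      labelledWeight p ℓ g y r ε x := by
  simp [proposalWeight, labelledWeight, Model.responsePosterior, hx]

end Weights

/-! ### Adapted proposals and their limit -/

section LimitProposal

variable {X Y : Type*} [Fintype X] {d m : ℕ}

open Classical in
/-- The instances for which some label has a nonzero loss: almost surely these are the instances
that are ever labelled. -/
noncomputable def relevantInstances (ℓ : X → Y → EuclideanSpace ℝ (Fin d)) : Finset X :=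
  {x | ∃ y', ℓ x y' ≠ 0}

lemma mem_relevantInstances {ℓ : X → Y → EuclideanSpace ℝ (Fin d)} {x : X} :
    x ∈ relevantInstances ℓ ↔ ∃ y', ℓ x y' ≠ 0 := by
  simp [relevantInstances]

/-- The almost sure limit of the proposals. -/
noncomputable def limitProposal (p : X → ℝ) (ℓ : X → Y → EuclideanSpace ℝ (Fin d))
    (g : EuclideanSpace ℝ (Fin d) → EuclideanSpace ℝ (Fin m)) (y : X → Y) (ε₀ : ℝ)
    (r : EuclideanSpace ℝ (Fin d)) (x : X) : ℝ :=
  labelledWeight p ℓ g y r (epsilon ε₀ (relevantInstances ℓ)) x /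
    ∑ x', labelledWeight p ℓ g y r (epsilon ε₀ (relevantInstances ℓ)) x'

variable {p : X → ℝ} {ℓ : X → Y → EuclideanSpace ℝ (Fin d)}
  {g : EuclideanSpace ℝ (Fin d) → EuclideanSpace ℝ (Fin m)} {y : X → Y} {ε₀ : ℝ}
  {r : EuclideanSpace ℝ (Fin d)}

lemma sum_labelledWeight_pos (hp : ∀ x, 0 < p x) (hne : ∃ x, ℓ x (y x) ≠ 0)
    (hnd : ∀ x, ℓ x (y x) ≠ 0 → fderiv ℝ g r (ℓ x (y x)) ≠ 0) (ε : ℝ) :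
    0 < ∑ x, labelledWeight p ℓ g y r ε x := by
  obtain ⟨x, hx⟩ := hne
  exact Finset.sum_pos' (fun x _ => labelledWeight_nonneg hp x)
    ⟨x, Finset.mem_univ x, labelledWeight_pos hp hx (Or.inr (hnd x hx))⟩

lemma limitProposal_nonneg (hp : ∀ x, 0 < p x) (x : X) : 0 ≤ limitProposal p ℓ g y ε₀ r x :=
  div_nonneg (labelledWeight_nonneg hp x)
    (Finset.sum_nonneg fun x _ => labelledWeight_nonneg hp x)

lemma limitProposal_pos (hp : ∀ x, 0 < p x)
    (hnd : ∀ x, ℓ x (y x) ≠ 0 → fderiv ℝ g r (ℓ x (y x)) ≠ 0) {x : X} (hx : ℓ x (y x) ≠ 0) :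
    0 < limitProposal p ℓ g y ε₀ r x :=
  div_pos (labelledWeight_pos hp hx (Or.inr (hnd x hx))) (sum_labelledWeight_pos hp ⟨x, hx⟩ hnd _)

lemma sum_limitProposal (hp : ∀ x, 0 < p x) (hne : ∃ x, ℓ x (y x) ≠ 0)
    (hnd : ∀ x, ℓ x (y x) ≠ 0 → fderiv ℝ g r (ℓ x (y x)) ≠ 0) :
    ∑ x, limitProposal p ℓ g y ε₀ r x = 1 := by
  simp_rw [limitProposal, ← Finset.sum_div]
  exact div_self (sum_labelledWeight_pos hp hne hnd _).ne'

lemma limitProposal_eq_optProposal [Nonempty X] (hall : ∀ x, ∃ y', ℓ x y' ≠ 0) :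
    limitProposal p ℓ g y ε₀ (risk p ℓ y) = optProposal p ℓ g y := by
  have hL : relevantInstances ℓ = Finset.univ := by
    ext x; simp [mem_relevantInstances, hall x]
  funext x
  simp_rw [limitProposal, optProposal, hL, epsilon_univ, labelledWeight_zero]

lemma tendsto_sum_mul_of_eventually_eq_zero {A : X → Prop} {q h : ℕ → X → ℝ} {q' h' : X → ℝ}
    (hq : ∀ x, Tendsto (fun t => q t x) atTop (𝓝 (q' x)))
    (hq0 : ∀ᶠ t in atTop, ∀ x, ¬ A x → q t x = 0)
    (hh : ∀ x, A x → Tendsto (fun t => h t x) atTop (𝓝 (h' x))) :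
    Tendsto (fun t => ∑ x, q t x * h t x) atTop (𝓝 (∑ x, q' x * h' x)) := by
  refine tendsto_finsetSum _ fun x _ => ?_
  by_cases hx : A x
  · exact (hq x).mul (hh x hx)
  · have h0 : ∀ᶠ t in atTop, q t x = 0 := hq0.mono fun t ht => ht x hx
    have h1 : q' x = 0 := tendsto_nhds_unique (hq x)
      (tendsto_const_nhds.congr' (h0.mono fun t ht => ht.symm))
    rw [h1, zero_mul]
    exact tendsto_const_nhds.congr' (h0.mono fun t ht => by simp only [ht, zero_mul])

end LimitProposal

section AdaptedProposals

variable {V X Y : Type*} [Fintype V] [Fintype X] [Fintype Y] {d m : ℕ}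

/-- The proposal `q` is proportional to the weights computed from EM estimates `φ`, when the labels
on `O` are known and `r` is the current estimate of the risk. -/
structure IsAdaptedProposal (Md : Model V X Y) (p : X → ℝ)
    (ℓ : X → Y → EuclideanSpace ℝ (Fin d))
    (g : EuclideanSpace ℝ (Fin d) → EuclideanSpace ℝ (Fin m)) (y : X → Y) (ε₀ : ℝ)
    (O : Finset X) (φ : Md.Params) (r : EuclideanSpace ℝ (Fin d)) (q : X → ℝ) : Prop where
  em : Model.IsEMEstimate y O φ
  pmf : IsPmf q
  eq : ∀ x, q x *
      ∑ x', proposalWeight p ℓ g r (epsilon ε₀ O) (Model.responsePosterior φ y O) x' =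
    proposalWeight p ℓ g r (epsilon ε₀ O) (Model.responsePosterior φ y O) x

variable {Md : Model V X Y} {p : X → ℝ} {ℓ : X → Y → EuclideanSpace ℝ (Fin d)}
  {g : EuclideanSpace ℝ (Fin d) → EuclideanSpace ℝ (Fin m)} {y : X → Y} {ε₀ : ℝ}
  {O : Finset X} {φ : Md.Params} {r : EuclideanSpace ℝ (Fin d)} {q : X → ℝ}

namespace IsAdaptedProposal

lemma weight_nonneg (h : IsAdaptedProposal Md p ℓ g y ε₀ O φ r q) (hp : ∀ x, 0 < p x) (x : X) :
    0 ≤ proposalWeight p ℓ g r (epsilon ε₀ O) (Model.responsePosterior φ y O) x :=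
  proposalWeight_nonneg hp (Model.responsePosterior_nonneg h.em.mem_paramSpace y O) x

lemma weight_pos (h : IsAdaptedProposal Md p ℓ g y ε₀ O φ r q) (hp : ∀ x, 0 < p x)
    (hMd : Md.ProperPrior) (hε₀ : 0 < ε₀) {x : X} (hx : ℓ x (y x) ≠ 0)
    (hO : O = Finset.univ → fderiv ℝ g r (ℓ x (y x)) ≠ 0) :
    0 < proposalWeight p ℓ g r (epsilon ε₀ O) (Model.responsePosterior φ y O) x := by
  by_cases hxO : x ∈ O
  · rw [proposalWeight_of_mem φ hxO]
    refine labelledWeight_pos hp hx ?_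
    by_cases hO' : O = Finset.univ
    · exact Or.inr (hO hO')
    · exact Or.inl (epsilon_pos hε₀ hO')
  · have hO' : O ≠ Finset.univ := fun h' => hxO (h' ▸ Finset.mem_univ x)
    obtain ⟨δ, hδ, hδ'⟩ := hMd.exists_le_responsePosterior y
    refine (mul_pos (hp x) (mul_pos (epsilon_pos hε₀ hO') hδ)).trans_le ?_
    exact le_proposalWeight hp (Model.responsePosterior_nonneg h.em.mem_paramSpace y O)
      (epsilon_nonneg hε₀ O) (hδ' O φ h.em x hxO (y x)) hx

/-- The support condition can only fail when the whole pool is labelled and the derivative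
annihilates a nonzero loss. -/
lemma hasSupport (h : IsAdaptedProposal Md p ℓ g y ε₀ O φ r q) (hp : ∀ x, 0 < p x)
    (hMd : Md.ProperPrior) (hε₀ : 0 < ε₀)
    (hO : O = Finset.univ → ∀ x, ℓ x (y x) ≠ 0 → fderiv ℝ g r (ℓ x (y x)) ≠ 0) :
    HasSupport p ℓ y q := by
  intro x hx
  have hx' : ℓ x (y x) ≠ 0 := norm_ne_zero_iff.1 (left_ne_zero_of_mul hx)
  have hw := h.weight_pos hp hMd hε₀ hx' fun hO' => hO hO' x hx'
  rw [← h.eq x] at hw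
  exact pos_of_mul_pos_left hw (Finset.sum_nonneg fun x _ => h.weight_nonneg hp x)

lemma eq_zero (h : IsAdaptedProposal Md p ℓ g y ε₀ O φ r q) (hp : ∀ x, 0 < p x)
    (hMd : Md.ProperPrior) (hε₀ : 0 < ε₀) (hne : ∃ x, ℓ x (y x) ≠ 0) (hO : O ≠ Finset.univ)
    {x : X} (hx : x ∉ relevantInstances ℓ) : q x = 0 := by
  obtain ⟨x₀, hx₀⟩ := hne
  have hw := h.weight_pos hp hMd hε₀ hx₀ fun h' => absurd h' hO
  have hsum := Finset.sum_pos' (fun x _ => h.weight_nonneg hp x) ⟨x₀, Finset.mem_univ _, hw⟩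
  have hxz := h.eq x
  -- The weight of `x` is zero while the total weight is positive.
  rw [mem_relevantInstances] at hx
  push Not at hx
  rw [proposalWeight_eq_zero hx] at hxz
  exact (mul_eq_zero.1 hxz).resolve_right hsum.ne'

end IsAdaptedProposal

/-- An unlabelled instance with a possibly nonzero loss is drawn with a probability that is
bounded below. -/
lemma exists_le_adaptedProposal (hp : ∀ x, 0 < p x) (hMd : Md.ProperPrior) (hε₀ : 0 < ε₀)
    (K : ℝ) {x : X} (hx : x ∈ relevantInstances ℓ) :
    ∃ c > 0, ∀ (O : Finset X) (φ : Md.Params) (r : EuclideanSpace ℝ (Fin d)) (q : X → ℝ),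
      IsAdaptedProposal Md p ℓ g y ε₀ O φ r q → ‖fderiv ℝ g r‖ ≤ K → x ∉ O → c ≤ q x := by
  obtain ⟨δ, hδ, hδ'⟩ := hMd.exists_le_responsePosterior y
  obtain ⟨y', hy'⟩ := mem_relevantInstances.1 hx
  have hX : (0 : ℝ) < Fintype.card X := by exact_mod_cast Fintype.card_pos_iff.2 ⟨x⟩
  set U := ∑ x', p x' * ∑ y', (K * ‖ℓ x' y'‖ + ε₀) with hU
  have hU1 : 0 < |U| + 1 := by positivity
  have hc : 0 < p x * (ε₀ / Fintype.card X * δ) := mul_pos (hp x) (by positivity)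
  refine ⟨p x * (ε₀ / Fintype.card X * δ) / (|U| + 1), div_pos hc hU1,
    fun O φ r q h hK hxO => ?_⟩
  have hO : O ≠ Finset.univ := fun h' => hxO (h' ▸ Finset.mem_univ x)
  have hmem := h.em.mem_paramSpace
  have h1 := le_proposalWeight (g := g) (r := r) hp (Model.responsePosterior_nonneg hmem y O)
    (epsilon_nonneg hε₀ O) (hδ' O φ h.em x hxO y') hy'
  have h2 : ∑ x', proposalWeight p ℓ g r (epsilon ε₀ O) (Model.responsePosterior φ y O) x' ≤ U :=
    Finset.sum_le_sum fun x' _ => proposalWeight_le hp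
      (Model.responsePosterior_le_one hmem y O) (epsilon_nonneg hε₀ O) (epsilon_le hε₀ O) hK x'
  have h3 : p x * (ε₀ / Fintype.card X * δ) ≤ p x * (epsilon ε₀ O * δ) :=
    mul_le_mul_of_nonneg_left (mul_le_mul_of_nonneg_right (le_epsilon hε₀ hO) hδ.le) (hp x).le
  rw [div_le_iff₀ hU1]
  refine h3.trans (h1.trans ?_)
  rw [← h.eq x]
  refine mul_le_mul_of_nonneg_left (h2.trans ?_) (h.pmf.1 x)
  linarith [le_abs_self U]

/-- Once all relevant instances are labelled, and nothing else, the proposals converge; eventually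
they vanish where the loss of the true label does. -/
lemma tendsto_adaptedProposal {O : ℕ → Finset X} {φ : ℕ → Md.Params}
    {R : ℕ → EuclideanSpace ℝ (Fin d)} {q : ℕ → X → ℝ}
    (h : ∀ t, IsAdaptedProposal Md p ℓ g y ε₀ (O t) (φ t) (R t) (q t)) (hp : ∀ x, 0 < p x)
    (hO : ∀ᶠ t in atTop, O t = relevantInstances ℓ) (hR : Tendsto R atTop (𝓝 r))
    (hDg : ContinuousAt (fderiv ℝ g) r) (hne : ∃ x, ℓ x (y x) ≠ 0)
    (hnd : ∀ x, ℓ x (y x) ≠ 0 → fderiv ℝ g r (ℓ x (y x)) ≠ 0) :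
    (∀ x, Tendsto (fun t => q t x) atTop (𝓝 (limitProposal p ℓ g y ε₀ r x))) ∧
      ∀ᶠ t in atTop, ∀ x, ℓ x (y x) = 0 → q t x = 0 := by
  set ε := epsilon ε₀ (relevantInstances ℓ)
  have hlim := tendsto_labelledWeight (p := p) (ℓ := ℓ) (y := y) hR hDg ε
  have hsum : Tendsto (fun t => ∑ x, labelledWeight p ℓ g y (R t) ε x) atTop
      (𝓝 (∑ x, labelledWeight p ℓ g y r ε x)) := tendsto_finsetSum _ fun x _ => hlim x
  have hpos := sum_labelledWeight_pos hp hne hnd ε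
  have hev : ∀ᶠ t in atTop, ∀ x, q t x =
      labelledWeight p ℓ g y (R t) ε x / ∑ x', labelledWeight p ℓ g y (R t) ε x' := by
    filter_upwards [hO, hsum.eventually_const_lt hpos] with t ht hts x
    have hw : ∀ x, proposalWeight p ℓ g (R t) (epsilon ε₀ (O t))
        (Model.responsePosterior (φ t) y (O t)) x = labelledWeight p ℓ g y (R t) ε x := by
      intro x
      by_cases hx : x ∈ O t
      · rw [proposalWeight_of_mem (φ t) hx, ht]
      · rw [ht, mem_relevantInstances] at hx
        push Not at hx
        rw [proposalWeight_eq_zero hx, labelledWeight_eq_zero (hx (y x))]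
    have h1 := (h t).eq x
    simp_rw [hw] at h1
    rw [eq_div_iff hts.ne', h1]
  refine ⟨fun x => ?_, ?_⟩
  · refine ((hlim x).div hsum hpos.ne').congr' ?_
    filter_upwards [hev] with t ht
    exact (ht x).symm
  · filter_upwards [hev] with t ht x hx
    rw [ht x, labelledWeight_eq_zero hx, zero_div]

end AdaptedProposals

/-! ### Conditional expectations given the sample history -/

section History

variable {Ω X Y : Type*}

/-- The first `n` samples. -/
def past (S : ℕ → Ω → X) (n : ℕ) (ω : Ω) : Fin n → X := fun i => S i ω

lemma factorsThrough_past_mono {S : ℕ → Ω → X} {n k : ℕ} (hnk : n ≤ k) {β : Type*} {f : Ω → β}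
    (hf : f.FactorsThrough (past S n)) : f.FactorsThrough (past S k) := fun _ _ h =>
  hf (funext fun i => congrFun h ⟨i, i.2.trans_le hnk⟩)

lemma factorsThrough_sample {S : ℕ → Ω → X} {n j : ℕ} (hj : j < n) :
    (S j).FactorsThrough (past S n) := fun _ _ h => congrFun h ⟨j, hj⟩

lemma measurable_of_factorsThrough_past [Finite X] (S : ℕ → Ω → X) (y : X → Y) {n : ℕ}
    {β : Type*} [MeasurableSpace β] [Nonempty β] {f : Ω → β}
    (hf : f.FactorsThrough (past S n)) : Measurable[sampleHistory S y n] f := by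
  obtain ⟨e, rfl⟩ := (Function.factorsThrough_iff f).1 hf
  let _ : MeasurableSpace (Fin n → X) := ⊤
  have hpast : Measurable[sampleHistory S y n] (past S n) := by
    refine @measurable_to_countable' _ _ _ _ (sampleHistory S y n) _ fun h => ?_
    have heq : past S n ⁻¹' {h} = ⋂ i : Fin n, S i ⁻¹' {h i} := by
      ext ω
      simp [past, funext_iff]
    rw [heq]
    refine MeasurableSet.iInter fun i => ?_
    have hle : MeasurableSpace.comap (fun ω => (S i ω, y (S i ω))) ⊤ ≤ sampleHistory S y n :=
      le_iSup₂ (f := fun (i : ℕ) (_ : i ∈ Finset.range n) =>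
        MeasurableSpace.comap (fun ω => (S i ω, y (S i ω))) ⊤) (i : ℕ) (Finset.mem_range.2 i.2)
    exact hle _ ⟨{z | z.1 = h i}, trivial, rfl⟩
  exact measurable_from_top.comp hpast

lemma exists_bound_of_factorsThrough_past [Finite X] {S : ℕ → Ω → X} {n : ℕ} {f : Ω → ℝ}
    (hf : f.FactorsThrough (past S n)) : ∃ B, ∀ ω, |f ω| ≤ B := by
  obtain ⟨e, rfl⟩ := (Function.factorsThrough_iff f).1 hf
  obtain ⟨B, hB⟩ := (Set.finite_range fun h => |e h|).bddAbove
  exact ⟨B, fun ω => hB ⟨past S n ω, rfl⟩⟩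

variable [m0 : MeasurableSpace Ω]

/-- The σ-algebras generated by the samples and their labels, as a filtration. -/
def historyFiltration [Finite X] (S : ℕ → Ω → X) (y : X → Y)
    (hS : ∀ j x, MeasurableSet (S j ⁻¹' {x})) : Filtration ℕ m0 where
  seq := sampleHistory S y
  mono' n k hnk := biSup_mono fun i hi =>
    Finset.mem_range.2 ((Finset.mem_range.1 hi).trans_le hnk)
  le' n := by
    refine iSup₂_le fun i _ => ?_
    rintro _ ⟨t, -, rfl⟩
    have heq : (fun ω => (S i ω, y (S i ω))) ⁻¹' t = ⋃ x ∈ {x | (x, y x) ∈ t}, S i ⁻¹' {x} := by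
      ext ω
      simp
    rw [heq]
    exact MeasurableSet.biUnion (Set.to_countable _) fun x _ => hS i x

variable [Fintype X] {μ : Measure Ω} [IsProbabilityMeasure μ] {S : ℕ → Ω → X} {y : X → Y}

/-- If `Q` is the conditional law of the next sample, conditional expectations of functions of the
next sample and of the past are finite sums. -/
lemma condExp_sample (hS : ∀ j x, MeasurableSet (S j ⁻¹' {x})) {j : ℕ} {Q : Ω → X → ℝ}
    (hQ : ∀ x, μ[(S j ⁻¹' {x}).indicator (fun _ => (1 : ℝ)) | sampleHistory S y j]
      =ᵐ[μ] fun ω => Q ω x)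
    {G : X → Ω → ℝ} (hG : ∀ x, (G x).FactorsThrough (past S j)) :
    μ[fun ω => G (S j ω) ω | sampleHistory S y j] =ᵐ[μ] fun ω => ∑ x, Q ω x * G x ω := by
  classical
  have hle : sampleHistory S y j ≤ m0 := (historyFiltration S y hS).le j
  have hGm : ∀ x, StronglyMeasurable[sampleHistory S y j] (G x) := fun x =>
    (measurable_of_factorsThrough_past S y (hG x)).stronglyMeasurable
  have hind : ∀ x, Integrable ((S j ⁻¹' {x}).indicator (fun _ => (1 : ℝ))) μ := fun x =>
    (integrable_const 1).indicator (hS j x)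
  have hint : ∀ x, Integrable (G x * (S j ⁻¹' {x}).indicator (fun _ => (1 : ℝ))) μ := by
    intro x
    obtain ⟨B, hB⟩ := exists_bound_of_factorsThrough_past (hG x)
    exact (hind x).bdd_mul ((hGm x).mono hle).aestronglyMeasurable (.of_forall hB)
  have heq : (fun ω => G (S j ω) ω) =
      ∑ x, G x * (S j ⁻¹' {x}).indicator (fun _ => (1 : ℝ)) := by
    funext ω
    rw [Finset.sum_apply, Finset.sum_eq_single (S j ω)]
    · simp
    · intro x _ hx
      simp [Set.indicator, hx.symm]
    · simp
  rw [heq]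
  have h1 := condExp_finsetSum (μ := μ) (s := Finset.univ) (fun x _ => hint x)
    (sampleHistory S y j)
  have h2 : ∀ᵐ ω ∂μ, ∀ x,
      (μ[G x * (S j ⁻¹' {x}).indicator (fun _ => (1 : ℝ)) | sampleHistory S y j]) ω =
        Q ω x * G x ω := by
    refine ae_all_iff.2 fun x => ?_
    filter_upwards [condExp_mul_of_stronglyMeasurable_left (hGm x) (hint x) (hind x), hQ x]
      with ω h3 h4
    rw [h3, Pi.mul_apply, h4, mul_comm]
  filter_upwards [h1, h2] with ω h3 h4
  rw [h3, Finset.sum_apply]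
  exact Finset.sum_congr rfl fun x _ => h4 x

lemma integral_sample (hS : ∀ j x, MeasurableSet (S j ⁻¹' {x})) {j : ℕ} {Q : Ω → X → ℝ}
    (hQ : ∀ x, μ[(S j ⁻¹' {x}).indicator (fun _ => (1 : ℝ)) | sampleHistory S y j]
      =ᵐ[μ] fun ω => Q ω x)
    {G : X → Ω → ℝ} (hG : ∀ x, (G x).FactorsThrough (past S j)) :
    ∫ ω, G (S j ω) ω ∂μ = ∫ ω, ∑ x, Q ω x * G x ω ∂μ := by
  rw [← integral_condExp ((historyFiltration S y hS).le j)]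
  exact integral_congr_ae (condExp_sample hS hQ hG)

end History

/-! ### Stages -/

section Stages

variable {N : ℕ → ℕ}

lemma sampleCount_stage_le (N : ℕ → ℕ) (j : ℕ) : sampleCount N (stage N j) ≤ j :=
  Nat.findGreatest_spec (P := fun t => sampleCount N t ≤ j) (Nat.zero_le j) (by simp [sampleCount])

lemma tendsto_stage (N : ℕ → ℕ) : Tendsto (stage N) atTop atTop := by
  refine tendsto_atTop.2 fun b => ?_
  filter_upwards [eventually_ge_atTop (max b (sampleCount N b))] with j hj
  exact Nat.le_findGreatest (P := fun t => sampleCount N t ≤ j)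
    ((le_max_left _ _).trans hj) ((le_max_right _ _).trans hj)

lemma le_sampleCount (hN : ∀ t, 1 ≤ N t) (t : ℕ) : t ≤ sampleCount N t := by
  have := Finset.card_nsmul_le_sum (Finset.range t) N 1 fun s _ => hN s
  simpa [sampleCount] using this

end Stages

/-! ### The labelled instances and the proposals along a run -/

section Unseen

variable {Ω X : Type*} {N : ℕ → ℕ} {S : ℕ → Ω → X}

lemma mem_labelled {t : ℕ} {ω : Ω} {x : X} :
    x ∈ labelled N S t ω ↔ ∃ i < sampleCount N t, S i ω = x := by
  simp [labelled]

open Classical in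
/-- The indicator of the event that `x` is not among the first `n` samples. -/
noncomputable def unseen (S : ℕ → Ω → X) (x : X) (n : ℕ) (ω : Ω) : ℝ :=
  if ∀ i < n, S i ω ≠ x then 1 else 0

lemma unseen_nonneg (x : X) (n : ℕ) (ω : Ω) : 0 ≤ unseen S x n ω := by
  unfold unseen
  split_ifs
  · exact zero_le_one
  · exact le_rfl

lemma factorsThrough_unseen (x : X) (n : ℕ) : (unseen S x n).FactorsThrough (past S n) := by
  classical
  intro ω ω' h
  have h' : ∀ i < n, S i ω = S i ω' := fun i hi => factorsThrough_sample hi h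
  have hiff : (∀ i < n, S i ω ≠ x) ↔ ∀ i < n, S i ω' ≠ x :=
    forall₂_congr fun i hi => by rw [h' i hi]
  exact if_congr hiff rfl rfl

end Unseen

section Run

variable {Ω V X Y : Type*} [Fintype V] [Fintype X] [Fintype Y] [MeasurableSpace Ω]
  {μ : Measure Ω} {d m : ℕ} {p : X → ℝ} {ℓ : X → Y → EuclideanSpace ℝ (Fin d)}
  {g : EuclideanSpace ℝ (Fin d) → EuclideanSpace ℝ (Fin m)} {y : X → Y} {Md : Model V X Y}
  {N : ℕ → ℕ} {ε₀ : ℝ} {S : ℕ → Ω → X} {φ : ℕ → Ω → Md.Params}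
  {Rhat : ℕ → Ω → EuclideanSpace ℝ (Fin d)} {q : ℕ → Ω → X → ℝ}

namespace IsRun

lemma isAdaptedProposal (hrun : IsRun μ Md N p ℓ g y ε₀ S φ Rhat q) (t : ℕ) (ω : Ω) :
    IsAdaptedProposal Md p ℓ g y ε₀ (labelled N S t ω) (φ t ω) (Rhat t ω) (q t ω) :=
  ⟨hrun.em t ω, hrun.proposal_pmf t ω, hrun.proposal_eq t ω⟩

lemma proposal_past (hrun : IsRun μ Md N p ℓ g y ε₀ S φ Rhat q) (j : ℕ) :
    (q (stage N j)).FactorsThrough (past S j) :=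
  factorsThrough_past_mono (sampleCount_stage_le N j) (hrun.proposal_history (stage N j))

lemma integrable_of_factorsThrough_past [IsProbabilityMeasure μ]
    (hrun : IsRun μ Md N p ℓ g y ε₀ S φ Rhat q) {n : ℕ} {f : Ω → ℝ}
    (hf : f.FactorsThrough (past S n)) : Integrable f μ := by
  obtain ⟨B, hB⟩ := exists_bound_of_factorsThrough_past hf
  have hm := (measurable_of_factorsThrough_past S y hf).stronglyMeasurable.mono
    ((historyFiltration S y hrun.measurable_sample).le n)
  exact .of_bound hm.aestronglyMeasurable B (.of_forall hB)

variable [IsProbabilityMeasure μ]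

/-- Every relevant instance is sampled eventually: as long as it is unseen, it is drawn with a
probability that is bounded below. -/
lemma ae_exists_sample_eq (hrun : IsRun μ Md N p ℓ g y ε₀ S φ Rhat q) (hp : ∀ x, 0 < p x)
    (hMd : Md.ProperPrior) (hε₀ : 0 < ε₀) {K : ℝ}
    (hK : ∀ᵐ ω ∂μ, ∀ t, ‖fderiv ℝ g (Rhat t ω)‖ ≤ K) {x : X} (hx : x ∈ relevantInstances ℓ) :
    ∀ᵐ ω ∂μ, ∃ i, S i ω = x := by
  classical
  obtain ⟨c, hc, hcq⟩ := exists_le_adaptedProposal (g := g) (y := y) hp hMd hε₀ K hx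
  -- The bound is capped at one so that the powers of `1 - c'` are nonnegative.
  set c' := min c 1 with hc'
  have hc'0 : 0 < c' := lt_min hc one_pos
  have hc'1 : c' ≤ 1 := min_le_right _ _
  have hint : ∀ n, Integrable (unseen S x n) μ := fun n =>
    hrun.integrable_of_factorsThrough_past (factorsThrough_unseen x n)
  have hstep : ∀ n, ∫ ω, unseen S x (n + 1) ω ∂μ ≤ (1 - c') * ∫ ω, unseen S x n ω ∂μ := by
    intro n
    have hG : ∀ x', (fun ω => (if x' = x then 0 else 1) * unseen S x n ω).FactorsThrough
        (past S n) := fun x' ω ω' h => by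
      simp only [factorsThrough_unseen x n h]
    have heq : ∀ ω, unseen S x (n + 1) ω = (if S n ω = x then 0 else 1) * unseen S x n ω := by
      intro ω
      simp only [unseen, Nat.forall_lt_succ_right]
      by_cases h1 : S n ω = x <;> simp [h1]
    simp_rw [heq]
    rw [integral_sample (y := y) hrun.measurable_sample (hrun.sample_law n) hG,
      ← integral_const_mul]
    refine integral_mono_ae ?_ ((hint n).const_mul _) ?_
    · refine hrun.integrable_of_factorsThrough_past (n := n) fun ω ω' h => ?_
      simp only [hrun.proposal_past n h, factorsThrough_unseen x n h]
    · filter_upwards [hK] with ω hω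
      have hsum : ∑ x', q (stage N n) ω x' * ((if x' = x then 0 else 1) * unseen S x n ω) =
          (1 - q (stage N n) ω x) * unseen S x n ω := by
        have hq1 : 1 - q (stage N n) ω x = ∑ x' ∈ Finset.univ.erase x, q (stage N n) ω x' := by
          rw [Finset.sum_erase_eq_sub (Finset.mem_univ x), (hrun.proposal_pmf _ ω).2]
        rw [hq1, Finset.sum_mul, ← Finset.sum_erase (a := x) _ (by simp)]
        refine Finset.sum_congr rfl fun x' hx' => ?_
        rw [if_neg (Finset.ne_of_mem_erase hx'), one_mul]
      simp only [hsum]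
      by_cases hu : ∀ i < n, S i ω ≠ x
      · refine mul_le_mul_of_nonneg_right (sub_le_sub_left ?_ 1) (unseen_nonneg x n ω)
        refine (min_le_left _ _).trans (hcq _ _ _ _ (hrun.isAdaptedProposal _ ω) (hω _) ?_)
        rw [mem_labelled]
        rintro ⟨i, hi, hix⟩
        exact hu i (hi.trans_le (sampleCount_stage_le N n)) hix
      · simp [unseen, hu]
  have hpow : ∀ n, ∫ ω, unseen S x n ω ∂μ ≤ (1 - c') ^ n := by
    intro n
    induction n with
    | zero => simp [unseen]
    | succ n ih =>
      rw [pow_succ']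
      exact (hstep n).trans (mul_le_mul_of_nonneg_left ih (by linarith))
  set Z := {ω | ∀ i, S i ω ≠ x} with hZ
  have hZm : MeasurableSet Z := by
    have : Z = ⋂ i, (S i ⁻¹' {x})ᶜ := by
      ext ω; simp [hZ]
    rw [this]
    exact MeasurableSet.iInter fun i => (hrun.measurable_sample i x).compl
  have hle : ∀ n, μ.real Z ≤ (1 - c') ^ n := by
    intro n
    refine le_trans ?_ (hpow n)
    rw [← integral_indicator_one hZm]
    refine integral_mono ((integrable_const 1).indicator hZm) (hint n) fun ω => ?_
    by_cases hω : ω ∈ Z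
    · rw [Set.indicator_of_mem hω, unseen, if_pos fun i _ => hω i, Pi.one_apply]
    · rw [Set.indicator_of_notMem hω]
      exact unseen_nonneg x n ω
  have h0 : μ.real Z ≤ 0 := ge_of_tendsto'
    (tendsto_pow_atTop_nhds_zero_of_lt_one (by linarith) (by linarith)) hle
  have h1 : μ Z = 0 := by
    rw [← measureReal_eq_zero_iff]
    exact le_antisymm h0 measureReal_nonneg
  have h2 : ∀ᵐ ω ∂μ, ω ∉ Z := measure_eq_zero_iff_ae_notMem.1 h1
  filter_upwards [h2] with ω hω
  by_contra hcon
  push Not at hcon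
  exact hω hcon

/-- An irrelevant instance is never sampled: before its first draw its weight vanishes. -/
lemma ae_forall_sample_ne (hrun : IsRun μ Md N p ℓ g y ε₀ S φ Rhat q) (hp : ∀ x, 0 < p x)
    (hMd : Md.ProperPrior) (hε₀ : 0 < ε₀) (hne : ∃ x, ℓ x (y x) ≠ 0) {x : X}
    (hx : x ∉ relevantInstances ℓ) : ∀ᵐ ω ∂μ, ∀ i, S i ω ≠ x := by
  classical
  have hfirst : ∀ j, ∀ᵐ ω ∂μ, (if S j ω = x then 1 else 0) * unseen S x j ω = 0 := by
    intro j
    have hG : ∀ x', (fun ω => (if x' = x then 1 else 0) * unseen S x j ω).FactorsThrough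
        (past S j) := fun x' ω ω' h => by
      simp only [factorsThrough_unseen x j h]
    have hzero : ∫ ω, (if S j ω = x then 1 else 0) * unseen S x j ω ∂μ = 0 := by
      rw [integral_sample (y := y) hrun.measurable_sample (hrun.sample_law j) hG]
      refine integral_eq_zero_of_ae (.of_forall fun ω => ?_)
      simp only [ite_mul, one_mul, zero_mul, mul_ite, mul_zero, Finset.sum_ite_eq',
        Finset.mem_univ, if_true, Pi.zero_apply]
      by_cases hu : ∀ i < j, S i ω ≠ x
      · rw [(hrun.isAdaptedProposal (stage N j) ω).eq_zero hp hMd hε₀ hne ?_ hx, zero_mul]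
        -- The pool is not completely labelled, because `x` itself is not.
        intro huniv
        obtain ⟨i, hi, hix⟩ := mem_labelled.1 (huniv ▸ Finset.mem_univ x)
        exact hu i (hi.trans_le (sampleCount_stage_le N j)) hix
      · simp [unseen, hu]
    have hnn : ∀ ω, 0 ≤ (if S j ω = x then (1 : ℝ) else 0) * unseen S x j ω := fun ω =>
      mul_nonneg (by split_ifs <;> simp) (unseen_nonneg x j ω)
    have hI : Integrable (fun ω => (if S j ω = x then (1 : ℝ) else 0) * unseen S x j ω) μ := by
      refine hrun.integrable_of_factorsThrough_past (n := j + 1) fun ω ω' h => ?_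
      simp only [factorsThrough_sample (Nat.lt_succ_self j) h,
        factorsThrough_past_mono (Nat.le_succ j) (factorsThrough_unseen x j) h]
    exact (integral_eq_zero_iff_of_nonneg hnn hI).1 hzero
  filter_upwards [ae_all_iff.2 hfirst] with ω hω
  intro j
  induction j using Nat.strong_induction_on with
  | _ j ih =>
    intro hj
    have h1 := hω j
    rw [if_pos hj, one_mul, unseen, if_pos ih] at h1
    exact one_ne_zero h1

/-- Almost surely the labelled instances are eventually the relevant ones. -/
lemma ae_eventually_labelled (hrun : IsRun μ Md N p ℓ g y ε₀ S φ Rhat q) (hp : ∀ x, 0 < p x)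
    (hMd : Md.ProperPrior) (hN : ∀ t, 1 ≤ N t) (hε₀ : 0 < ε₀) {K : ℝ}
    (hK : ∀ᵐ ω ∂μ, ∀ t, ‖fderiv ℝ g (Rhat t ω)‖ ≤ K) (hne : ∃ x, ℓ x (y x) ≠ 0) :
    ∀ᵐ ω ∂μ, ∀ᶠ t in atTop, labelled N S t ω = relevantInstances ℓ := by
  have h1 : ∀ᵐ ω ∂μ, ∀ x, x ∈ relevantInstances ℓ → ∃ i, S i ω = x := by
    refine ae_all_iff.2 fun x => ?_
    by_cases hx : x ∈ relevantInstances ℓ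
    · filter_upwards [hrun.ae_exists_sample_eq hp hMd hε₀ hK hx] with ω hω _ using hω
    · exact .of_forall fun ω h => absurd h hx
  have h2 : ∀ᵐ ω ∂μ, ∀ x, x ∉ relevantInstances ℓ → ∀ i, S i ω ≠ x := by
    refine ae_all_iff.2 fun x => ?_
    by_cases hx : x ∈ relevantInstances ℓ
    · exact .of_forall fun ω h => absurd hx h
    · filter_upwards [hrun.ae_forall_sample_ne hp hMd hε₀ hne hx] with ω hω _ using hω
  filter_upwards [h1, h2] with ω h3 h4
  have h5 : ∀ᶠ t in atTop, ∀ x, x ∈ relevantInstances ℓ → x ∈ labelled N S t ω := by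
    refine eventually_all.2 fun x => ?_
    by_cases hx : x ∈ relevantInstances ℓ
    · obtain ⟨i, hi⟩ := h3 x hx
      filter_upwards [eventually_gt_atTop i] with t ht _
      exact mem_labelled.2 ⟨i, ht.trans_le (le_sampleCount hN t), hi⟩
    · exact .of_forall fun t h => absurd h hx
  filter_upwards [h5] with t ht
  refine Finset.Subset.antisymm (fun x hx => ?_) fun x hx => ht x hx
  by_contra hx'
  obtain ⟨i, -, hi⟩ := mem_labelled.1 hx
  exact h4 x hx' i hi

lemma ae_tendsto_proposal (hrun : IsRun μ Md N p ℓ g y ε₀ S φ Rhat q) (hp : ∀ x, 0 < p x)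
    (hMd : Md.ProperPrior) (hN : ∀ t, 1 ≤ N t) (hε₀ : 0 < ε₀) {K : ℝ}
    (hK : ∀ᵐ ω ∂μ, ∀ t, ‖fderiv ℝ g (Rhat t ω)‖ ≤ K) {Rinf : EuclideanSpace ℝ (Fin d)}
    (hRhat : ∀ᵐ ω ∂μ, Tendsto (fun t => Rhat t ω) atTop (𝓝 Rinf))
    (hDg : ContinuousAt (fderiv ℝ g) Rinf) (hne : ∃ x, ℓ x (y x) ≠ 0)
    (hnd : ∀ x, ℓ x (y x) ≠ 0 → fderiv ℝ g Rinf (ℓ x (y x)) ≠ 0) :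
    ∀ᵐ ω ∂μ, (∀ x, Tendsto (fun t => q t ω x) atTop
        (𝓝 (limitProposal p ℓ g y ε₀ Rinf x))) ∧
      ∀ᶠ t in atTop, ∀ x, ℓ x (y x) = 0 → q t ω x = 0 := by
  filter_upwards [hrun.ae_eventually_labelled hp hMd hN hε₀ hK hne, hRhat] with ω h1 h2
  exact tendsto_adaptedProposal (fun t => hrun.isAdaptedProposal t ω) hp h1 h2 hDg hne hnd

end IsRun

end Run

/-! ### Truncated contributions -/

section Truncation

variable {X Y : Type*} [Fintype X] {d : ℕ} {p : X → ℝ}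
  {ℓ : X → Y → EuclideanSpace ℝ (Fin d)} {y : X → Y}

lemma continuousAt_contribution {q' : X → ℝ} {x : X} (hq : ℓ x (y x) ≠ 0 → q' x ≠ 0) :
    ContinuousAt (fun q : X → ℝ => contribution p ℓ y q x) q' := by
  by_cases hx : ℓ x (y x) = 0
  · simp only [contribution, hx, smul_zero]
    exact continuousAt_const
  · have h1 : ContinuousAt (fun q : X → ℝ => p x / q x) q' :=
      continuousAt_const.div (continuous_apply x).continuousAt (hq hx)
    exact (h1.smul continuousAt_const).sub continuousAt_const

/-- The proposal vanishes where the loss of the true label does, and is at least `δ` elsewhere. -/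
def IsGoodProposal (ℓ : X → Y → EuclideanSpace ℝ (Fin d)) (y : X → Y) (δ : ℝ) (q : X → ℝ) :
    Prop :=
  ∀ x, (ℓ x (y x) ≠ 0 → δ ≤ q x) ∧ (ℓ x (y x) = 0 → q x = 0)

open Classical in
/-- The centred contribution of an instance, replaced by zero if it is drawn from a proposal that
is not good: a bounded quantity, centred under every proposal. -/
noncomputable def truncContribution (p : X → ℝ) (ℓ : X → Y → EuclideanSpace ℝ (Fin d))
    (y : X → Y) (δ : ℝ) (q : X → ℝ) (x : X) : EuclideanSpace ℝ (Fin d) :=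
  if IsGoodProposal ℓ y δ q then contribution p ℓ y q x else 0

lemma exists_norm_truncContribution_le (hp : ∀ x, 0 < p x) {δ : ℝ} (hδ : 0 < δ) :
    ∃ B, ∀ q x, ‖truncContribution p ℓ y δ q x‖ ≤ B := by
  have hnn : ∀ x, 0 ≤ p x / δ * ‖ℓ x (y x)‖ := fun x =>
    mul_nonneg (div_nonneg (hp x).le hδ.le) (norm_nonneg _)
  refine ⟨∑ x, p x / δ * ‖ℓ x (y x)‖ + ‖risk p ℓ y‖, fun q x => ?_⟩
  rw [truncContribution]
  split_ifs with hq
  · refine (norm_sub_le _ _).trans (add_le_add_left ?_ _)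
    refine le_trans ?_ (Finset.single_le_sum (f := fun x => p x / δ * ‖ℓ x (y x)‖)
      (fun x _ => hnn x) (Finset.mem_univ x))
    by_cases hx : ℓ x (y x) = 0
    · simp [hx]
    · have h1 := (hq x).1 hx
      rw [norm_smul, Real.norm_of_nonneg (div_nonneg (hp x).le (hδ.le.trans h1))]
      exact mul_le_mul_of_nonneg_right (div_le_div_of_nonneg_left (hp x).le hδ h1)
        (norm_nonneg _)
  · rw [norm_zero]
    exact add_nonneg (Finset.sum_nonneg fun x _ => hnn x) (norm_nonneg _)

lemma sum_mul_inner_truncContribution {δ : ℝ} (hδ : 0 < δ) {q : X → ℝ} (hq : ∑ x, q x = 1)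
    (u : EuclideanSpace ℝ (Fin d)) :
    ∑ x, q x * inner ℝ (truncContribution p ℓ y δ q x) u = 0 := by
  by_cases hg : IsGoodProposal ℓ y δ q
  · simp_rw [truncContribution, if_pos hg, ← real_inner_smul_left, ← sum_inner]
    rw [sum_smul_contribution hq fun x hx => (hδ.trans_le ((hg x).1 hx)).ne', inner_zero_left]
  · simp [truncContribution, hg]

lemma exists_eventually_isGoodProposal {q' : X → ℝ} (hq' : ∀ x, ℓ x (y x) ≠ 0 → 0 < q' x) :
    ∃ δ > 0, ∀ q : ℕ → X → ℝ, (∀ x, Tendsto (fun t => q t x) atTop (𝓝 (q' x))) →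
      (∀ᶠ t in atTop, ∀ x, ℓ x (y x) = 0 → q t x = 0) →
      ∀ᶠ t in atTop, IsGoodProposal ℓ y δ (q t) := by
  obtain ⟨δ, hδ, hδ'⟩ : ∃ δ > 0, ∀ x, ℓ x (y x) ≠ 0 → δ < q' x := by
    classical
    have hev : ∀ᶠ δ in 𝓝[>] (0 : ℝ), ∀ x, ℓ x (y x) ≠ 0 → δ < q' x := by
      refine eventually_all.2 fun x => ?_
      by_cases hx : ℓ x (y x) = 0
      · exact .of_forall fun δ h => absurd hx h
      · filter_upwards [nhdsWithin_le_nhds (eventually_lt_nhds (hq' x hx))] with δ h _ using h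
    obtain ⟨δ, h1, h2⟩ := (hev.and self_mem_nhdsWithin).exists
    exact ⟨δ, h2, h1⟩
  refine ⟨δ, hδ, fun q hq hq0 => ?_⟩
  have h1 : ∀ᶠ t in atTop, ∀ x, ℓ x (y x) ≠ 0 → δ ≤ q t x := by
    refine eventually_all.2 fun x => ?_
    by_cases hx : ℓ x (y x) = 0
    · exact .of_forall fun t h => absurd hx h
    · filter_upwards [(hq x).eventually_const_lt (hδ' x hx)] with t h _ using h.le
  filter_upwards [h1, hq0] with t h2 h3 x
  exact ⟨h2 x, h3 x⟩

lemma tendsto_smul_sum_of_eventually_eq_zero {E : Type*} [NormedAddCommGroup E]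
    [NormedSpace ℝ E] {f : ℕ → E} (hf : ∀ᶠ j in atTop, f j = 0) {c : ℕ → ℝ}
    (hc : Tendsto c atTop (𝓝 0)) :
    Tendsto (fun n => c n • ∑ j ∈ Finset.range n, f j) atTop (𝓝 0) := by
  obtain ⟨n₀, hn₀⟩ := eventually_atTop.1 hf
  have h1 : Tendsto (fun n => c n • ∑ j ∈ Finset.range n₀, f j) atTop (𝓝 0) := by
    simpa using hc.smul_const (∑ j ∈ Finset.range n₀, f j)
  refine h1.congr' ?_
  filter_upwards [eventually_ge_atTop n₀] with n hn
  rw [Finset.eventually_constant_sum hn₀ hn]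

variable {Ω : Type*} {N : ℕ → ℕ} {S : ℕ → Ω → X} {q : ℕ → Ω → X → ℝ}

lemma riskAIS_sub_risk {n : ℕ} (hn : n ≠ 0) (ω : Ω) :
    riskAIS N p ℓ y S q n ω - risk p ℓ y =
      (1 / (n : ℝ)) • ∑ j ∈ Finset.range n, contribution p ℓ y (q (stage N j) ω) (S j ω) := by
  have hn' : (n : ℝ) ≠ 0 := Nat.cast_ne_zero.2 hn
  simp only [contribution, Finset.sum_sub_distrib, smul_sub, Finset.sum_const, Finset.card_range]
  rw [← Nat.cast_smul_eq_nsmul ℝ, smul_smul, one_div_mul_cancel hn', one_smul]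
  rfl

lemma sqrt_smul_riskAIS_sub_risk (n : ℕ) (ω : Ω) :
    √(n : ℝ) • (riskAIS N p ℓ y S q n ω - risk p ℓ y) =
      (√(n : ℝ))⁻¹ • ∑ j ∈ Finset.range n, contribution p ℓ y (q (stage N j) ω) (S j ω) := by
  rcases eq_or_ne n 0 with rfl | hn
  · simp
  · have h0 : (0 : ℝ) < n := by positivity
    rw [riskAIS_sub_risk hn, smul_smul]
    congr 1
    rw [mul_one_div, Real.sqrt_div_self', one_div]

lemma ae_eventually_contribution_eq_trunc [MeasurableSpace Ω] {μ : Measure Ω} {δ : ℝ}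
    (hgood : ∀ᵐ ω ∂μ, ∀ᶠ t in atTop, IsGoodProposal ℓ y δ (q t ω)) :
    ∀ᵐ ω ∂μ, ∀ᶠ j in atTop, contribution p ℓ y (q (stage N j) ω) (S j ω) -
      truncContribution p ℓ y δ (q (stage N j) ω) (S j ω) = 0 := by
  filter_upwards [hgood] with ω hω
  filter_upwards [(tendsto_stage N).eventually hω] with j hj
  rw [truncContribution, if_pos hj, sub_self]

end Truncation

/-! ### Limits along a run -/

section Limits

variable {Ω V X Y : Type*} [Fintype V] [Fintype X] [Fintype Y] [MeasurableSpace Ω]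
  {μ : Measure Ω} {d m : ℕ} {p : X → ℝ}
  {ℓ : X → Y → EuclideanSpace ℝ (Fin d)}
  {g : EuclideanSpace ℝ (Fin d) → EuclideanSpace ℝ (Fin m)} {y : X → Y} {Md : Model V X Y}
  {N : ℕ → ℕ} {ε₀ : ℝ} {S : ℕ → Ω → X} {φ : ℕ → Ω → Md.Params}
  {Rhat : ℕ → Ω → EuclideanSpace ℝ (Fin d)} {q : ℕ → Ω → X → ℝ} {q' : X → ℝ}

/-- The proposals converge almost surely to the deterministic limit `q'`, which charges exactly
the instances with a nonzero loss, and the proposals eventually charge no other instance. -/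
structure HasLimitProposal (μ : Measure Ω) (ℓ : X → Y → EuclideanSpace ℝ (Fin d)) (y : X → Y)
    (q : ℕ → Ω → X → ℝ) (q' : X → ℝ) : Prop where
  pmf : IsPmf q'
  pos : ∀ x, ℓ x (y x) ≠ 0 → 0 < q' x
  ae_tendsto : ∀ᵐ ω ∂μ, (∀ x, Tendsto (fun t => q t ω x) atTop (𝓝 (q' x))) ∧
    ∀ᶠ t in atTop, ∀ x, ℓ x (y x) = 0 → q t ω x = 0

namespace IsRun

lemma factorsThrough_comp_sample (hrun : IsRun μ Md N p ℓ g y ε₀ S φ Rhat q) {β : Type*}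
    (Φ : X → (X → ℝ) → β) {j n : ℕ} (hj : j < n) :
    (fun ω => Φ (S j ω) (q (stage N j) ω)).FactorsThrough (past S n) := fun ω ω' h => by
  simp only [factorsThrough_sample hj h,
    factorsThrough_past_mono hj.le (hrun.proposal_past j) h]

lemma measurable_of_past (hrun : IsRun μ Md N p ℓ g y ε₀ S φ Rhat q) {n : ℕ} {β : Type*}
    [MeasurableSpace β] [Nonempty β] {f : Ω → β} (hf : f.FactorsThrough (past S n)) :
    Measurable f :=
  (measurable_of_factorsThrough_past S y hf).mono
    ((historyFiltration S y hrun.measurable_sample).le n) le_rfl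

lemma factorsThrough_riskAIS (hrun : IsRun μ Md N p ℓ g y ε₀ S φ Rhat q) (n : ℕ) :
    (riskAIS N p ℓ y S q n).FactorsThrough (past S n) := fun ω ω' h => by
  unfold riskAIS
  refine congrArg _ (Finset.sum_congr rfl fun j hj => ?_)
  exact hrun.factorsThrough_comp_sample (fun x r => (p x / r x) • ℓ x (y x))
    (Finset.mem_range.1 hj) h

variable [IsProbabilityMeasure μ]

lemma condExp_eq (hrun : IsRun μ Md N p ℓ g y ε₀ S φ Rhat q) (Φ : X → (X → ℝ) → ℝ) (j : ℕ) :
    μ[fun ω => Φ (S j ω) (q (stage N j) ω) | sampleHistory S y j] =ᵐ[μ]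
      fun ω => ∑ x, q (stage N j) ω x * Φ x (q (stage N j) ω) :=
  condExp_sample (G := fun x ω => Φ x (q (stage N j) ω)) hrun.measurable_sample
    (hrun.sample_law j) fun x ω ω' h => by simp only [hrun.proposal_past j h]

/-- Conditional moments of the contributions converge to the moments under the limit proposal. -/
lemma ae_tendsto_condExp (hrun : IsRun μ Md N p ℓ g y ε₀ S φ Rhat q)
    (hlim : HasLimitProposal μ ℓ y q q') {Φ : X → (X → ℝ) → ℝ}
    (hΦ : ∀ x, ℓ x (y x) ≠ 0 → ContinuousAt (Φ x) q') :
    ∀ᵐ ω ∂μ, Tendsto (fun j =>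
        (μ[fun ω => Φ (S j ω) (q (stage N j) ω) | sampleHistory S y j]) ω) atTop
      (𝓝 (∑ x, q' x * Φ x q')) := by
  filter_upwards [ae_all_iff.2 (hrun.condExp_eq Φ), hlim.ae_tendsto] with ω h1 ⟨h2, h3⟩
  simp_rw [h1]
  refine tendsto_sum_mul_of_eventually_eq_zero (A := fun x => ℓ x (y x) ≠ 0)
    (fun x => (h2 x).comp (tendsto_stage N)) ?_ fun x hx => ?_
  · filter_upwards [(tendsto_stage N).eventually h3] with j hj x hx
    exact hj x (not_not.1 hx)
  · exact (hΦ x hx).tendsto.comp ((tendsto_pi_nhds.2 h2).comp (tendsto_stage N))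

/-- The conditional means are subtracted in the conditional covariances; they tend to zero, since
the limit proposal satisfies the support condition. -/
lemma ae_tendsto_condCov (hrun : IsRun μ Md N p ℓ g y ε₀ S φ Rhat q)
    (hlim : HasLimitProposal μ ℓ y q q') :
    ∀ᵐ ω ∂μ, Tendsto (fun j => condCov μ N p ℓ y S q j ω) atTop
      (𝓝 (proposalCov p ℓ y q')) := by
  set M : Fin d → (X → ℝ) → ℝ := fun a r => ∑ x, r x * contribution p ℓ y r x a with hM
  have hcont : ∀ a x, ContinuousAt (fun r : X → ℝ => contribution p ℓ y r x a) q' := fun a x =>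
    (EuclideanSpace.proj (𝕜 := ℝ) a).continuous.continuousAt.comp
      (continuousAt_contribution fun hx => (hlim.pos x hx).ne')
  have hMcont : ∀ a, ContinuousAt (M a) q' := fun a =>
    tendsto_finsetSum _ fun x _ => ((continuous_apply x).continuousAt).mul (hcont a x)
  have hM0 : ∀ a, M a q' = 0 := fun a => by
    have h1 := congrArg (fun z : EuclideanSpace ℝ (Fin d) => z a)
      (sum_smul_contribution (p := p) hlim.pmf.2 fun x hx => (hlim.pos x hx).ne')
    simpa [hM] using h1
  have hmean : ∀ j a, μ[increment N p ℓ y S q j a | sampleHistory S y j] =ᵐ[μ]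
      fun ω => M a (q (stage N j) ω) := fun j a =>
    hrun.condExp_eq (fun x r => contribution p ℓ y r x a) j
  have hentry : ∀ a b, ∀ᵐ ω ∂μ, Tendsto (fun j => condCov μ N p ℓ y S q j ω a b) atTop
      (𝓝 (proposalCov p ℓ y q' a b)) := by
    intro a b
    have h1 := hrun.ae_tendsto_condExp hlim (Φ := fun x r =>
      (contribution p ℓ y r x a - M a r) * (contribution p ℓ y r x b - M b r)) fun x _ =>
      ((hcont a x).sub (hMcont a)).mul ((hcont b x).sub (hMcont b))
    have h2 : ∀ j, (fun ω => condCov μ N p ℓ y S q j ω a b) =ᵐ[μ]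
        μ[fun ω => (contribution p ℓ y (q (stage N j) ω) (S j ω) a - M a (q (stage N j) ω)) *
          (contribution p ℓ y (q (stage N j) ω) (S j ω) b - M b (q (stage N j) ω)) |
          sampleHistory S y j] := by
      intro j
      refine condExp_congr_ae ?_
      filter_upwards [hmean j a, hmean j b] with ω h3 h4
      rw [h3, h4]
      rfl
    filter_upwards [h1, ae_all_iff.2 h2] with ω h3 h4
    simp only [hM0, sub_zero] at h3
    rw [proposalCov_apply]
    exact h3.congr fun j => (h4 j).symm
  have hall := ae_all_iff.2 fun a => ae_all_iff.2 (hentry a)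
  filter_upwards [hall] with ω hω
  exact tendsto_pi_nhds.2 fun a => tendsto_pi_nhds.2 fun b => hω a b

section Truncated

variable {δ : ℝ}

/-- The truncated contributions in the direction `u` are bounded martingale differences. -/
lemma isBoundedMDS (hrun : IsRun μ Md N p ℓ g y ε₀ S φ Rhat q) (hδ : 0 < δ) {B : ℝ}
    (hB : ∀ r x, ‖truncContribution p ℓ y δ r x‖ ≤ B) (u : EuclideanSpace ℝ (Fin d)) :
    IsBoundedMDS μ (historyFiltration S y hrun.measurable_sample)
      (fun j ω => inner ℝ (truncContribution p ℓ y δ (q (stage N j) ω) (S j ω)) u)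
      (B * ‖u‖) where
  adapted j := (measurable_of_factorsThrough_past S y (hrun.factorsThrough_comp_sample
    (fun x r => inner ℝ (truncContribution p ℓ y δ r x) u) (Nat.lt_succ_self j))).stronglyMeasurable
  bound j ω := (abs_real_inner_le_norm _ _).trans
    (mul_le_mul_of_nonneg_right (hB _ _) (norm_nonneg _))
  condExp_eq_zero j := by
    filter_upwards [hrun.condExp_eq (fun x r => inner ℝ (truncContribution p ℓ y δ r x) u) j]
      with ω hω
    exact hω.trans (sum_mul_inner_truncContribution hδ (hrun.proposal_pmf _ ω).2 u)

lemma ae_tendsto_average_trunc (hrun : IsRun μ Md N p ℓ g y ε₀ S φ Rhat q) (hp : ∀ x, 0 < p x)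
    (hδ : 0 < δ) :
    ∀ᵐ ω ∂μ, Tendsto (fun n : ℕ => (1 / (n : ℝ)) • ∑ j ∈ Finset.range n,
      truncContribution p ℓ y δ (q (stage N j) ω) (S j ω)) atTop (𝓝 0) := by
  obtain ⟨B, hB⟩ := exists_norm_truncContribution_le (ℓ := ℓ) (y := y) hp hδ
  have h := ae_all_iff.2 fun a : Fin d =>
    (hrun.isBoundedMDS hδ hB (EuclideanSpace.single a 1)).ae_tendsto_average
  filter_upwards [h] with ω hω
  have h1 : Tendsto (fun n : ℕ => WithLp.ofLp ((1 / (n : ℝ)) • ∑ j ∈ Finset.range n,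
      truncContribution p ℓ y δ (q (stage N j) ω) (S j ω))) atTop (𝓝 0) := by
    refine tendsto_pi_nhds.2 fun a => (hω a).congr fun n => ?_
    simp [EuclideanSpace.inner_single_right, div_eq_inv_mul]
  have h2 := ((PiLp.continuous_toLp 2 fun _ : Fin d => ℝ).tendsto 0).comp h1
  simpa [Function.comp_def] using h2

/-- The central limit theorem for the truncated contributions. -/
lemma tendstoInDistribution_trunc (hrun : IsRun μ Md N p ℓ g y ε₀ S φ Rhat q)
    (hp : ∀ x, 0 < p x) (hlim : HasLimitProposal μ ℓ y q q') (hδ : 0 < δ)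
    (hgood : ∀ᵐ ω ∂μ, ∀ᶠ t in atTop, IsGoodProposal ℓ y δ (q t ω)) :
    TendstoInDistribution (fun (n : ℕ) ω => (√(n : ℝ))⁻¹ • ∑ j ∈ Finset.range n,
        truncContribution p ℓ y δ (q (stage N j) ω) (S j ω)) atTop id (fun _ => μ)
      (multivariateGaussian 0 (proposalCov p ℓ y q')) := by
  obtain ⟨B, hB⟩ := exists_norm_truncContribution_le (ℓ := ℓ) (y := y) hp hδ
  refine tendstoInDistribution_multivariateGaussian (proposalCov_posSemidef hlim.pmf.1)
    (fun n => hrun.measurable_of_past (n := n) fun ω ω' h => ?_) fun u => ?_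
  · refine congrArg _ (Finset.sum_congr rfl fun j hj => ?_)
    exact hrun.factorsThrough_comp_sample (fun x r => truncContribution p ℓ y δ r x)
      (Finset.mem_range.1 hj) h
  · set s : ℕ → Ω → ℝ := fun j ω => ∑ x, q (stage N j) ω x *
      inner ℝ (truncContribution p ℓ y δ (q (stage N j) ω) x) u ^ 2 with hs
    have hsm : ∀ j, StronglyMeasurable[historyFiltration S y hrun.measurable_sample j] (s j) :=
      fun j => (measurable_of_factorsThrough_past S y fun ω ω' h => by
        simp only [hs, hrun.proposal_past j h]).stronglyMeasurable
    have hsq : ∀ r x, inner ℝ (truncContribution p ℓ y δ r x) u ^ 2 ≤ (B * ‖u‖) ^ 2 := by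
      intro r x
      rw [← sq_abs]
      exact pow_le_pow_left₀ (abs_nonneg _) ((abs_real_inner_le_norm _ _).trans
        (mul_le_mul_of_nonneg_right (hB _ _) (norm_nonneg _))) 2
    have hsb : ∀ j ω, |s j ω| ≤ (B * ‖u‖) ^ 2 := by
      intro j ω
      have hpmf := hrun.proposal_pmf (stage N j) ω
      rw [abs_of_nonneg (Finset.sum_nonneg fun x _ => mul_nonneg (hpmf.1 x) (sq_nonneg _))]
      calc s j ω ≤ ∑ x, q (stage N j) ω x * (B * ‖u‖) ^ 2 :=
            Finset.sum_le_sum fun x _ => mul_le_mul_of_nonneg_left (hsq _ x) (hpmf.1 x)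
        _ = (B * ‖u‖) ^ 2 := by rw [← Finset.sum_mul, hpmf.2, one_mul]
    have hv : ∀ᵐ ω ∂μ, Tendsto (fun j => s j ω) atTop
        (𝓝 (u.ofLp ⬝ᵥ (proposalCov p ℓ y q').mulVec u.ofLp)) := by
      filter_upwards [hlim.ae_tendsto, hgood] with ω ⟨h1, h2⟩ h3
      rw [dotProduct_proposalCov_mulVec]
      refine tendsto_sum_mul_of_eventually_eq_zero (A := fun x => ℓ x (y x) ≠ 0)
        (fun x => (h1 x).comp (tendsto_stage N)) ?_ fun x hx => ?_
      · filter_upwards [(tendsto_stage N).eventually h2] with j hj x hx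
        exact hj x (not_not.1 hx)
      · have h4 : ContinuousAt (fun r : X → ℝ => inner ℝ (contribution p ℓ y r x) u ^ 2) q' :=
          (ContinuousAt.inner (continuousAt_contribution fun hx => (hlim.pos x hx).ne')
            continuousAt_const).pow 2
        have h5 := h4.tendsto.comp ((tendsto_pi_nhds.2 h1).comp (tendsto_stage N))
        rw [EuclideanSpace.inner_eq_star_dotProduct, star_trivial] at h5
        refine h5.congr' ?_
        filter_upwards [(tendsto_stage N).eventually h3] with j hj
        simp only [Function.comp_apply, truncContribution, if_pos hj]
    have hclt := (hrun.isBoundedMDS hδ hB u).tendsto_integral_exp hsm hsb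
      (hrun.condExp_eq fun x r => inner ℝ (truncContribution p ℓ y δ r x) u ^ 2) hv
    simp_rw [real_inner_smul_left, sum_inner]
    exact hclt

end Truncated

/-- Strong consistency of the risk estimate: eventually the contributions equal the truncated
ones. -/
theorem ae_tendsto_riskAIS (hrun : IsRun μ Md N p ℓ g y ε₀ S φ Rhat q) (hp : ∀ x, 0 < p x)
    {δ : ℝ} (hδ : 0 < δ) (hgood : ∀ᵐ ω ∂μ, ∀ᶠ t in atTop, IsGoodProposal ℓ y δ (q t ω)) :
    ∀ᵐ ω ∂μ, Tendsto (fun n => riskAIS N p ℓ y S q n ω) atTop (𝓝 (risk p ℓ y)) := by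
  filter_upwards [hrun.ae_tendsto_average_trunc hp hδ,
    ae_eventually_contribution_eq_trunc (N := N) (S := S) (p := p) hgood] with ω h1 h2
  have h3 := h1.add (tendsto_smul_sum_of_eventually_eq_zero h2
    (tendsto_one_div_atTop_nhds_zero_nat (𝕜 := ℝ)))
  rw [add_zero] at h3
  rw [← tendsto_sub_nhds_zero_iff]
  refine h3.congr' ?_
  filter_upwards [eventually_ne_atTop 0] with n hn
  rw [riskAIS_sub_risk hn, ← smul_add, ← Finset.sum_add_distrib]
  simp

theorem tendstoInDistribution_riskAIS (hrun : IsRun μ Md N p ℓ g y ε₀ S φ Rhat q)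
    (hp : ∀ x, 0 < p x) (hlim : HasLimitProposal μ ℓ y q q') {δ : ℝ} (hδ : 0 < δ)
    (hgood : ∀ᵐ ω ∂μ, ∀ᶠ t in atTop, IsGoodProposal ℓ y δ (q t ω)) :
    TendstoInDistribution (fun (n : ℕ) ω => √(n : ℝ) • (riskAIS N p ℓ y S q n ω - risk p ℓ y))
      atTop id (fun _ => μ) (multivariateGaussian 0 (proposalCov p ℓ y q')) := by
  have hT := hrun.tendstoInDistribution_trunc hp hlim hδ hgood
  have hmeas : ∀ n : ℕ, Measurable fun ω =>
      √(n : ℝ) • (riskAIS N p ℓ y S q n ω - risk p ℓ y) := fun n =>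
    hrun.measurable_of_past (n := n) fun ω ω' h => by
      simp only [hrun.factorsThrough_riskAIS n h]
  refine tendstoInDistribution_of_tendstoInMeasure_sub _ _ hT ?_ fun n => (hmeas n).aemeasurable
  refine tendstoInMeasure_of_tendsto_ae (fun n => ?_) ?_
  · exact ((hmeas n).aemeasurable.sub (hT.forall_aemeasurable n)).aestronglyMeasurable
  · filter_upwards [ae_eventually_contribution_eq_trunc (N := N) (S := S) (p := p) hgood]
      with ω hω
    have h1 := tendsto_smul_sum_of_eventually_eq_zero hω (c := fun n : ℕ => (√(n : ℝ))⁻¹)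
      (tendsto_inv_atTop_zero.comp (Real.tendsto_sqrt_atTop.comp tendsto_natCast_atTop_atTop))
    refine h1.congr fun n => ?_
    rw [Pi.sub_apply, Pi.sub_apply, sqrt_smul_riskAIS_sub_risk, ← smul_sub,
      Finset.sum_sub_distrib]

end IsRun

end Limits

end DirichletTreeAIS

open DirichletTreeAIS in
theorem proposition3 {Ω V X Y : Type*} [Fintype V] [Fintype X] [Fintype Y]
    [MeasurableSpace Ω] (μ : Measure Ω) [IsProbabilityMeasure μ] {d m : ℕ}
    -- the pool distribution, the loss, the mapping `g`, the deterministic oracle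
    (p : X → ℝ) (hp_pos : ∀ x, 0 < p x) (hp_sum : ∑ x, p x = 1)
    (ℓ : X → Y → EuclideanSpace ℝ (Fin d))
    (g : EuclideanSpace ℝ (Fin d) → EuclideanSpace ℝ (Fin m)) (y : X → Y)
    (hg : DifferentiableAt ℝ g (risk p ℓ y))
    -- the Dirichlet-tree model, the stage sizes, the run of the algorithm
    (Md : Model V X Y) (hMd : Md.ProperPrior)
    (N : ℕ → ℕ) (hN : ∀ t, 1 ≤ N t) (ε₀ : ℝ) (hε₀ : 0 < ε₀)
    (S : ℕ → Ω → X) (φ : ℕ → Ω → Md.Params) (Rhat : ℕ → Ω → EuclideanSpace ℝ (Fin d))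
    (q : ℕ → Ω → X → ℝ) (hrun : IsRun μ Md N p ℓ g y ε₀ S φ Rhat q)
    -- the risk estimates used in the proposals converge and the Jacobians are bounded
    (Rinf : EuclideanSpace ℝ (Fin d))
    (hRhat : ∀ᵐ ω ∂μ, Tendsto (fun t => Rhat t ω) atTop (𝓝 Rinf))
    (K : ℝ) (hK : ∀ᵐ ω ∂μ, ∀ t, DifferentiableAt ℝ g (Rhat t ω) ∧
      ‖fderiv ℝ g (Rhat t ω)‖ ≤ K)
    (hDg : ContinuousAt (fderiv ℝ g) Rinf)
    -- nondegeneracy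
    (hne : ∃ x, ℓ x (y x) ≠ 0)
    (hnd : ∀ x, ℓ x (y x) ≠ 0 → fderiv ℝ g Rinf (ℓ x (y x)) ≠ 0) :
    -- the support condition
    (∀ᵐ ω ∂μ,
      (∀ t, (labelled N S t ω = Finset.univ →
          ∀ x, ℓ x (y x) ≠ 0 → fderiv ℝ g (Rhat t ω) (ℓ x (y x)) ≠ 0) →
        HasSupport p ℓ y (q t ω)) ∧
      ∀ᶠ t in atTop, HasSupport p ℓ y (q t ω)) ∧
    -- bounded conditional second moments of the weights
    (∀ᵐ ω ∂μ, BddAbove (Set.range fun j =>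
      (μ[fun ω' => importanceWeight N p S q j ω' ^ 2 | sampleHistory S y j]) ω)) ∧
    -- strong consistency
    (∀ᵐ ω ∂μ, Tendsto (fun n => measureAIS N p ℓ g y S q n ω) atTop
      (𝓝 (g (risk p ℓ y)))) ∧
    -- bounded conditional moments of the weights of some order above two
    (∃ η : ℝ, 0 < η ∧ ∀ᵐ ω ∂μ, BddAbove (Set.range fun j =>
      (μ[fun ω' => importanceWeight N p S q j ω' ^ (2 + η) | sampleHistory S y j]) ω)) ∧
    ∃ Vinf : Matrix (Fin d) (Fin d) ℝ, Vinf.PosSemidef ∧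
      -- convergence of the conditional covariance matrices
      (∀ᵐ ω ∂μ, Tendsto (fun j => condCov μ N p ℓ y S q j ω) atTop (𝓝 Vinf)) ∧
      -- central limit theorem
      TendstoInDistribution
        (fun (n : ℕ) ω => √(n : ℝ) • (measureAIS N p ℓ g y S q n ω - g (risk p ℓ y)))
        atTop id (fun _ => μ) (multivariateGaussian 0 (deltaCov p ℓ g y Vinf)) ∧
      -- asymptotic optimality
      (Rinf = risk p ℓ y → (∀ x, ∃ y', ℓ x y' ≠ 0) →
        (∀ᵐ ω ∂μ, ∀ x, Tendsto (fun t => q t ω x) atTop (𝓝 (optProposal p ℓ g y x))) ∧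
        (deltaCov p ℓ g y Vinf).trace =
          (∑ x, optWeight p ℓ g y x) ^ 2 - ‖fderiv ℝ g (risk p ℓ y) (risk p ℓ y)‖ ^ 2 ∧
        IsLeast {s : ℝ | ∃ q' : X → ℝ, IsPmf q' ∧ HasSupport p ℓ y q' ∧
            s = (deltaCov p ℓ g y (proposalCov p ℓ y q')).trace}
          (deltaCov p ℓ g y Vinf).trace) := by
  have hX : Nonempty X := hne.nonempty
  have hK' : ∀ᵐ ω ∂μ, ∀ t, ‖fderiv ℝ g (Rhat t ω)‖ ≤ K := hK.mono fun ω h t => (h t).2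
  set q' := limitProposal p ℓ g y ε₀ Rinf with hq'
  have hlim : HasLimitProposal μ ℓ y q q' :=
    ⟨⟨limitProposal_nonneg hp_pos, sum_limitProposal hp_pos hne hnd⟩,
      fun x hx => limitProposal_pos hp_pos hnd hx,
      hrun.ae_tendsto_proposal hp_pos hMd hN hε₀ hK' hRhat hDg hne hnd⟩
  obtain ⟨δ, hδ, hδ'⟩ := exists_eventually_isGoodProposal hlim.pos
  have hgood : ∀ᵐ ω ∂μ, ∀ᶠ t in atTop, IsGoodProposal ℓ y δ (q t ω) :=
    hlim.ae_tendsto.mono fun ω h => hδ' _ h.1 h.2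
  have hcons := hrun.ae_tendsto_riskAIS hp_pos hδ hgood
  have hweight : ∀ x, ℓ x (y x) ≠ 0 → ContinuousAt (fun r : X → ℝ => p x / r x) q' :=
    fun x hx => continuousAt_const.div (continuous_apply x).continuousAt (hlim.pos x hx).ne'
  -- The order `2 + η` with `η = 1`: on a finite pool every conditional moment converges.
  refine ⟨hgood.mono fun ω hω => ⟨fun t ht => ?_, ?_⟩, ?_, ?_, ⟨1, one_pos, ?_⟩,
    proposalCov p ℓ y q', proposalCov_posSemidef hlim.pmf.1, hrun.ae_tendsto_condCov hlim, ?_,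
    fun hRinf hall => ?_⟩
  · exact (hrun.isAdaptedProposal t ω).hasSupport hp_pos hMd hε₀ ht
  · filter_upwards [hω] with t ht x hx
    exact hδ.trans_le ((ht x).1 (norm_ne_zero_iff.1 (left_ne_zero_of_mul hx)))
  · filter_upwards [hrun.ae_tendsto_condExp hlim (Φ := fun x r => (p x / r x) ^ 2)
      fun x hx => (hweight x hx).pow 2] with ω hω
    exact hω.bddAbove_range
  · filter_upwards [hcons] with ω hω
    exact hg.continuousAt.tendsto.comp hω
  · filter_upwards [hrun.ae_tendsto_condExp hlim (Φ := fun x r => (p x / r x) ^ (2 + 1 : ℝ))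
      fun x hx => (hweight x hx).rpow_const (Or.inr (by norm_num))] with ω hω
    exact hω.bddAbove_range
  · refine tendstoInDistribution_delta (proposalCov_posSemidef hlim.pmf.1) hg (fun n => ?_)
      (fun n => ?_) hcons (hrun.tendstoInDistribution_riskAIS hp_pos hlim hδ hgood)
    · exact hrun.measurable_of_past (hrun.factorsThrough_riskAIS n)
    · exact hrun.measurable_of_past (n := n) fun ω ω' h => by
        simp only [hrun.factorsThrough_riskAIS n h]
  · subst hRinf
    have hopt : q' = optProposal p ℓ g y := limitProposal_eq_optProposal hall
    rw [hopt]
    refine ⟨hlim.ae_tendsto.mono fun ω hω x => ?_, trace_deltaCov_optProposal hp_pos hne hnd,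
      isLeast_trace_deltaCov hp_pos hne hnd⟩
    rw [← hopt]
    exact hω.1 x
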